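/- Let $r$ be a positive integer or $\infty$, and let $n\ge 0$. An $r$-composition of $n$ is a pair $(\beta,\mu)$, where $\beta=(\beta_1,\dots,\beta_k)$ is a composition (a finite, possibly empty, list of positive integers) with all parts at least $r$, $\mu=(\mu_1\ge\dots\ge\mu_l)$ is a (possibly empty) partition with all parts strictly smaller than $r$, and $|\beta|+|\mu|=n$. The $r$-dominant monomial function of $(\beta,\mu)$ is $$M_{(\beta,\mu)}=\sum x_{i_1}^{\beta_1}\cdots x_{i_k}^{\beta_k}\,x_{i_{k+1}}^{\mu_1}\cdots x_{i_{k+l}}^{\mu_l}\in\mathbb{Q}[[x_1,x_2,\dots]],$$ where the sum is over all tuples of distinct positive integers $i_1,\dots,i_{k+l}$ such that $i_1<\cdots<i_k$, and $\mathrm{QSym}^r_n$ is the $\mathbb{Q}$-linear span of all $M_{(\beta,\mu)}$ with $(\beta,\mu)$ an $r$-composition of $n$. An edge-coloured digraph $G$ is a finite digraph without loops, with at most one edge from $a$ to $b$ for all distinct vertices $a,b$, in which each edge is dashed ($a\dashrightarrow b$), solid ($a\to b$) or double ($a\Rightarrow b$). A proper colouring of $G$ is a map $\kappa$ from its vertices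 to the positive integers such that $\kappa(a)\ne\kappa(b)$ if $a\dashrightarrow b$, $\kappa(a)<\kappa(b)$ if $a\to b$, and $\kappa(a)\le\kappa(b)$ if $a\Rightarrow b$. The generalized chromatic function of $G$ is $\mathscr{X}_G=\sum_\kappa\prod_{a\in V(G)}x_{\kappa(a)}$, summed over all proper colourings $\kappa$ of $G$. The dashed (respectively solid, double) sum of $G$ and $H$ is the disjoint union of $G$ and $H$ together with a dashed (respectively solid, double) edge from each vertex of $G$ to each vertex of $H$. Let $C_j$ be the directed cycle on $j$ vertices with double edges ($C_1$ is a single vertex without edges). For a partition $\mu$, let $G_\mu$ be the digraph with vertices the cells $(i,j)$, $1\le i\le l$, $1\le j\le\mu_i$, with solid edges $(i,j)\to(i+1,j)$ and double edges $(i,j)\Rightarrow(i,j+1)$. For an $r$-composition $(\beta,\mu)$ let $A_\beta$ and $B_\beta$ be, respectively, the solid sum and the double sum of $C_{\beta_1},\dots,C_{\beta_k}$ in this order, and let $D_\mu$ be the dashed sum of $C_{\mu_1},\dots,C_{\mu_l}$ in this order. Let $S_{(\beta,\mu)}$, $\overline{F}_{(\beta,\mu)}$ and $\overline{S}_{(\beta,\mu)}$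 be the generalized chromatic functions of the dashed sum of $A_\beta$ and $G_\mu$, of the dashed sum of $B_\beta$ and $D_\mu$, and of the dashed sum of $B_\beta$ and $G_\mu$, respectively. Theorem. For every $r$-composition $(\beta,\mu)$ of $n$, $M_{(\beta,\mu)}$ is the generalized chromatic function of the dashed sum of $A_\beta$ and $D_\mu$. Moreover, each of the four families $(M_{(\beta,\mu)})$, $(S_{(\beta,\mu)})$, $(\overline{F}_{(\beta,\mu)})$ and $(\overline{S}_{(\beta,\mu)})$, indexed by the $r$-compositions $(\beta,\mu)$ of $n$, is a basis of the $\mathbb{Q}$-vector space $\mathrm{QSym}^r_n$. -/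

import Mathlib

/-- The three kinds of edges `⇢`, `→`, `⇒`. -/
inductive EdgeColour where
  | dashed
  | solid
  | double

/-- A finite simple digraph (no loops, at most one edge from `a` to `b`) whose edges carry one of
the three colours: `edge a b = some c` says that `(a, b)` is an edge of colour `c`, and
`edge a b = none` says that `(a, b)` is not an edge. -/
structure ECDigraph where
  V : Type
  [fintypeV : Fintype V]
  edge : V → V → Option EdgeColour
  loopless : ∀ a, edge a a = none

attribute [instance] ECDigraph.fintypeV

namespace ECDigraph

/-- The digraph without vertices. -/
def empty : ECDigraph where
  V := Empty
  edge := fun _ _ => none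
  loopless := fun _ => rfl

/-- The dashed, solid or double sum of `G` and `H` (according to the colour `c`): the disjoint
union of `G` and `H` together with an edge of colour `c` from each vertex of `G` to each vertex
of `H`. -/
def sum (c : EdgeColour) (G H : ECDigraph) : ECDigraph where
  V := G.V ⊕ H.V
  edge
    | Sum.inl a, Sum.inl b => G.edge a b
    | Sum.inr a, Sum.inr b => H.edge a b
    | Sum.inl _, Sum.inr _ => some c
    | Sum.inr _, Sum.inl _ => none
  loopless
    | Sum.inl a => G.loopless a
    | Sum.inr a => H.loopless a

/-- The iterated sum of a list of digraphs, in the order of the list. -/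
def listSum (c : EdgeColour) (L : List ECDigraph) : ECDigraph :=
  L.foldr (ECDigraph.sum c) ECDigraph.empty

/-- The directed cycle `C_n` on `n` vertices with double edges. As digraphs have no loops, `C_1` is
a single vertex without edges. -/
def cycle (n : ℕ) : ECDigraph where
  V := Fin n
  edge := fun a b => if a ≠ b ∧ (a.val + 1) % n = b.val then some EdgeColour.double else none
  loopless := fun a => by simp

/-- The digraph `G_λ` of a list `λ` of row lengths: the vertices are the cells `(i, j)` of the
diagram, there is a solid edge from `(i, j)` to `(i + 1, j)` and a double edge from `(i, j)` to
`(i, j + 1)`. -/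
def ferrers (l : List ℕ) : ECDigraph where
  V := Σ i : Fin l.length, Fin (l.get i)
  edge := fun a b =>
    if a.1.val + 1 = b.1.val ∧ a.2.val = b.2.val then some EdgeColour.solid
    else if a.1.val = b.1.val ∧ a.2.val + 1 = b.2.val then some EdgeColour.double
    else none
  loopless := fun a => by simp

/-- Proper vertex-colourings of an edge-coloured digraph by positive integers. -/
def IsProper (G : ECDigraph) (κ : G.V → ℕ+) : Prop :=
  ∀ a b : G.V,
    (G.edge a b = some EdgeColour.dashed → κ a ≠ κ b) ∧
    (G.edge a b = some EdgeColour.solid → κ a < κ b) ∧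
    (G.edge a b = some EdgeColour.double → κ a ≤ κ b)

end ECDigraph

/-- The sum of a family of formal power series, taken coefficientwise. It is only used for families
in which each monomial has a nonzero coefficient in finitely many members. -/
noncomputable def formalSum {ι : Type} (f : ι → MvPowerSeries ℕ+ ℚ) : MvPowerSeries ℕ+ ℚ :=
  fun m => ∑ᶠ i : ι, MvPowerSeries.coeff m (f i)

/-- The generalized chromatic function `∑ x_κ` over the proper vertex-colourings `κ` of `G`, where
`x_κ = ∏ x_{κ(a)}` over the vertices `a`. -/
noncomputable def ECDigraph.chromaticFunction (G : ECDigraph) : MvPowerSeries ℕ+ ℚ :=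
  formalSum fun κ : {κ : G.V → ℕ+ // G.IsProper κ} =>
    ∏ a : G.V, (MvPowerSeries.X (κ.1 a) : MvPowerSeries ℕ+ ℚ)

/-- `r`-compositions `(β, μ)` of `n`, for `r` a positive integer or infinity: `β` is a composition
with all parts at least `r`, `μ` is a partition with all parts smaller than `r`, and
`|β| + |μ| = n`. -/
structure RComposition (r : ℕ∞) (n : ℕ) where
  β : List ℕ
  μ : List ℕ
  β_pos : ∀ p ∈ β, 0 < p
  μ_pos : ∀ p ∈ μ, 0 < p
  μ_decreasing : μ.Pairwise (fun p q => q ≤ p)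
  le_β : ∀ p ∈ β, r ≤ (p : ℕ∞)
  μ_lt : ∀ p ∈ μ, (p : ℕ∞) < r
  size_eq : β.sum + μ.sum = n

/-- The index tuples of the `r`-dominant monomial function: `i_1 < ⋯ < i_k` and
`i_{k+1}, …, i_{k+l}`, all distinct. -/
def DominantIndex (k l : ℕ) : Type :=
  {p : (Fin k → ℕ+) × (Fin l → ℕ+) //
    StrictMono p.1 ∧ Function.Injective p.2 ∧ ∀ a b, p.1 a ≠ p.2 b}

/-- A product of powers of variables with positive exponents determines, up to finitely many
choices, the variables. -/
theorem finite_prod_X_pow {α : Type} [Finite α] (e : α → ℕ) (he : ∀ a, e a ≠ 0) (m : ℕ+ →₀ ℕ) :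
    {i : α → ℕ+ | ∃ s : Finset α, (∀ a, a ∈ s) ∧
      MvPowerSeries.coeff m (∏ a ∈ s, (MvPowerSeries.X (i a) : MvPowerSeries ℕ+ ℚ) ^ e a) ≠ 0}.Finite
      := by
  classical
  refine (Set.Finite.pi' (t := fun _ : α => (m.support : Set ℕ+))
    (fun _ => m.support.finite_toSet)).subset ?_
  rintro i ⟨s, hs, h⟩ a
  have key : (∏ a ∈ s, (MvPowerSeries.X (i a) : MvPowerSeries ℕ+ ℚ) ^ e a)
      = MvPowerSeries.monomial (∑ a ∈ s, Finsupp.single (i a) (e a)) 1 := by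
    clear h hs
    induction s using Finset.induction_on with
    | empty => simp
    | insert b t hb ih =>
      rw [Finset.prod_insert hb, Finset.sum_insert hb, ih, MvPowerSeries.X_pow_eq,
        MvPowerSeries.monomial_mul_monomial, one_mul]
  rw [key, MvPowerSeries.coeff_monomial] at h
  have hm : m = ∑ a ∈ s, Finsupp.single (i a) (e a) := by
    by_contra hne
    simp [hne] at h
  have : 0 < m (i a) := by
    rw [hm, Finsupp.finsetSum_apply]
    refine lt_of_lt_of_le ?_ (Finset.single_le_sum (f := fun b => Finsupp.single (i b) (e b) (i a))
      (fun _ _ => Nat.zero_le _) (hs a))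
    simpa using Nat.pos_of_ne_zero (he a)
  simpa using this.ne'

/-- The sum defining the generalized chromatic function has finitely many nonzero terms in each
coefficient. -/
theorem ECDigraph.chromaticFunction_finite (G : ECDigraph) (m : ℕ+ →₀ ℕ) :
    (Function.support fun κ : {κ : G.V → ℕ+ // G.IsProper κ} => MvPowerSeries.coeff m
      (∏ a : G.V, (MvPowerSeries.X (κ.1 a) : MvPowerSeries ℕ+ ℚ))).Finite := by
  refine Set.Finite.subset
    ((finite_prod_X_pow (fun _ : G.V => 1) (by simp) m).preimage
      (Subtype.val_injective (p := fun κ : G.V → ℕ+ => G.IsProper κ)).injOn) ?_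
  intro κ hκ
  exact ⟨Finset.univ, fun a => Finset.mem_univ a, by simpa using hκ⟩

namespace RComposition

variable {r : ℕ∞} {n : ℕ}

/-- The `r`-dominant monomial function `M_{(β,μ)}`. -/
noncomputable def M (c : RComposition r n) : MvPowerSeries ℕ+ ℚ :=
  formalSum fun i : DominantIndex c.β.length c.μ.length =>
    (∏ a, (MvPowerSeries.X (i.1.1 a) : MvPowerSeries ℕ+ ℚ) ^ c.β.get a) *
      ∏ b, (MvPowerSeries.X (i.1.2 b) : MvPowerSeries ℕ+ ℚ) ^ c.μ.get b

/-- The sum defining `M_{(β,μ)}` has finitely many nonzero terms in each coefficient. -/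
theorem M_finite (c : RComposition r n) (m : ℕ+ →₀ ℕ) :
    (Function.support fun i : DominantIndex c.β.length c.μ.length => MvPowerSeries.coeff m
      ((∏ a, (MvPowerSeries.X (i.1.1 a) : MvPowerSeries ℕ+ ℚ) ^ c.β.get a) *
        ∏ b, (MvPowerSeries.X (i.1.2 b) : MvPowerSeries ℕ+ ℚ) ^ c.μ.get b)).Finite := by
  have hinj : Function.Injective (fun i : DominantIndex c.β.length c.μ.length =>
      Sum.elim i.1.1 i.1.2) := by
    intro i j h
    apply Subtype.ext
    apply Prod.ext
    · funext a
      exact congrFun h (Sum.inl a)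
    · funext b
      exact congrFun h (Sum.inr b)
  refine Set.Finite.subset
    ((finite_prod_X_pow (Sum.elim c.β.get c.μ.get) ?_ m).preimage hinj.injOn) ?_
  · rintro (a | b)
    · exact (c.β_pos _ (List.get_mem _ _)).ne'
    · exact (c.μ_pos _ (List.get_mem _ _)).ne'
  · intro i hi
    refine ⟨Finset.univ, fun a => Finset.mem_univ a, ?_⟩
    rw [Fintype.prod_sum_type]
    exact hi

/-- The solid sum of the cycles `C_{β_1}, …, C_{β_k}`, followed by the dashed sum with the dashed
sum of the cycles `C_{μ_1}, …, C_{μ_l}`. -/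
def digraphM (c : RComposition r n) : ECDigraph :=
  ECDigraph.sum EdgeColour.dashed
    (ECDigraph.listSum EdgeColour.solid (c.β.map ECDigraph.cycle))
    (ECDigraph.listSum EdgeColour.dashed (c.μ.map ECDigraph.cycle))

/-- The dashed sum of the solid sum of the cycles `C_{β_i}` and of `G_μ`. -/
def digraphS (c : RComposition r n) : ECDigraph :=
  ECDigraph.sum EdgeColour.dashed
    (ECDigraph.listSum EdgeColour.solid (c.β.map ECDigraph.cycle))
    (ECDigraph.ferrers c.μ)

/-- The dashed sum of the double sum of the cycles `C_{β_i}` and of the dashed sum of the cycles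
`C_{μ_j}`. -/
def digraphFbar (c : RComposition r n) : ECDigraph :=
  ECDigraph.sum EdgeColour.dashed
    (ECDigraph.listSum EdgeColour.double (c.β.map ECDigraph.cycle))
    (ECDigraph.listSum EdgeColour.dashed (c.μ.map ECDigraph.cycle))

/-- The dashed sum of the double sum of the cycles `C_{β_i}` and of `G_μ`. -/
def digraphSbar (c : RComposition r n) : ECDigraph :=
  ECDigraph.sum EdgeColour.dashed
    (ECDigraph.listSum EdgeColour.double (c.β.map ECDigraph.cycle))
    (ECDigraph.ferrers c.μ)

/-- `S_{(β,μ)}`. -/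
noncomputable def S (c : RComposition r n) : MvPowerSeries ℕ+ ℚ :=
  c.digraphS.chromaticFunction

/-- `F̄_{(β,μ)}`. -/
noncomputable def Fbar (c : RComposition r n) : MvPowerSeries ℕ+ ℚ :=
  c.digraphFbar.chromaticFunction

/-- `S̄_{(β,μ)}`. -/
noncomputable def Sbar (c : RComposition r n) : MvPowerSeries ℕ+ ℚ :=
  c.digraphSbar.chromaticFunction

end RComposition

/-- The space `QSym^r_n` of `r`-quasisymmetric functions of degree `n`: the rational span of the
`r`-dominant monomial functions of the `r`-compositions of `n`. -/
noncomputable def QSymR (r : ℕ∞) (n : ℕ) : Submodule ℚ (MvPowerSeries ℕ+ ℚ) :=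
  Submodule.span ℚ (Set.range fun c : RComposition r n => c.M)

/-! The coefficient of a monomial in a generalized chromatic function is the number of proper
colourings with that exponent vector, so the theorem is a matter of counting. Going round a directed
double cycle, all inequalities become equalities: a cycle is one block of a single colour. A sum of
cycles is thus coloured by choosing one colour per block, and for the dashed sum of `A_β` and `D_μ`
these choices are the index tuples of `M_{(β,μ)}`.

In each of the four dashed sums the first summand uses every colour at least `r` times or not at
all, and the second uses every colour fewer than `r` times. Since the two share no colour, the
coefficient at `m` is a product of counts at the exponents `≥ r` and the exponents `< r` of `m`
(`count_sum_dashed`). The first factor is quasisymmetric and the second symmetric, so the product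
depends only on the `r`-composition read off from `m`; hence all four families lie in `QSymR r n`.

For independence, a colouring of `A_β` or `B_β` has exponent list `β` or involves fewer colours than
`β` has parts, and a colouring of `D_μ` or `G_μ` has sorted exponents lexicographically at most `μ`;
equality does occur in both. The matrix of coefficients is therefore triangular with nonzero
diagonal. The families are indexed by one finite set, whose size is the dimension because the `M`
are themselves independent and span.

The facts about `G_μ` are those about Schur functions. Symmetry is the Bender–Knuth involution,
carried out on Gelfand–Tsetlin patterns, and triangularity holds because entries at most `v` of a
semistandard tableau lie in its first `v` rows. -/

namespace ECDigraph

/-! ### Coefficients of chromatic functions as numbers of colourings -/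

/-- The exponent vector of the monomial `∏ x_{κ(a)}`. -/
noncomputable def content {V : Type} [Fintype V] (κ : V → ℕ+) : ℕ+ →₀ ℕ :=
  ∑ a, Finsupp.single (κ a) 1

theorem content_apply {V : Type} [Fintype V] (κ : V → ℕ+) (v : ℕ+) :
    content κ v = ∑ a, if κ a = v then 1 else 0 := by
  simp [content, Finsupp.finsetSum_apply, Finsupp.single_apply]

theorem content_apply_ne_zero {V : Type} [Fintype V] (κ : V → ℕ+) (a : V) :
    content κ (κ a) ≠ 0 := by
  rw [content_apply]
  intro h
  have := (Finset.sum_eq_zero_iff.1 h) a (Finset.mem_univ a)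
  simp at this

theorem content_ne_zero_iff {V : Type} [Fintype V] (κ : V → ℕ+) (v : ℕ+) :
    content κ v ≠ 0 ↔ ∃ a, κ a = v := by
  constructor
  · intro h
    by_contra! hne
    apply h
    rw [content_apply]
    simp [hne]
  · rintro ⟨a, rfl⟩
    exact content_apply_ne_zero κ a

theorem degree_content {V : Type} [Fintype V] (κ : V → ℕ+) :
    (content κ).degree = Fintype.card V := by
  simp [content]

theorem content_sumElim {V W : Type} [Fintype V] [Fintype W] (κ : V ⊕ W → ℕ+) :
    content κ = content (κ ∘ Sum.inl) + content (κ ∘ Sum.inr) := by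
  simp [content]

theorem finite_content_eq {V : Type} [Fintype V] (m : ℕ+ →₀ ℕ) :
    {κ : V → ℕ+ | content κ = m}.Finite := by
  refine (Set.Finite.pi' (t := fun _ : V => (m.support : Set ℕ+))
    (fun _ => m.support.finite_toSet)).subset ?_
  rintro κ rfl a
  simpa using content_apply_ne_zero κ a

theorem prod_X_eq_monomial {V : Type} [Fintype V] (κ : V → ℕ+) :
    ∏ a, (MvPowerSeries.X (κ a) : MvPowerSeries ℕ+ ℚ) =
      MvPowerSeries.monomial (content κ) 1 := by
  classical
  unfold content
  induction (Finset.univ : Finset V) using Finset.induction_on with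
  | empty => simp
  | insert b t hb ih =>
    rw [Finset.prod_insert hb, Finset.sum_insert hb, ih, MvPowerSeries.X,
      MvPowerSeries.monomial_mul_monomial, one_mul]

/-- The number of proper colourings with a given exponent vector. -/
noncomputable def count (G : ECDigraph) (m : ℕ+ →₀ ℕ) : ℕ :=
  Nat.card {κ : G.V → ℕ+ // G.IsProper κ ∧ content κ = m}

/-- `Nat.card` is zero on infinite types, so finiteness is what lets a zero count mean that there is
no colouring. -/
theorem finite_colourings (G : ECDigraph) (m : ℕ+ →₀ ℕ) :
    Finite {κ : G.V → ℕ+ // G.IsProper κ ∧ content κ = m} :=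
  ((finite_content_eq m).subset fun _ h => h.2).to_subtype

theorem count_ne_zero_iff (G : ECDigraph) (m : ℕ+ →₀ ℕ) :
    G.count m ≠ 0 ↔ ∃ κ : G.V → ℕ+, G.IsProper κ ∧ content κ = m := by
  have := G.finite_colourings m
  rw [count, Nat.card_ne_zero, nonempty_subtype]
  simp [this]

theorem coeff_chromaticFunction (G : ECDigraph) (m : ℕ+ →₀ ℕ) :
    MvPowerSeries.coeff m G.chromaticFunction = (G.count m : ℚ) := by
  classical
  change ∑ᶠ κ : {κ : G.V → ℕ+ // G.IsProper κ}, MvPowerSeries.coeff m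
      (∏ a : G.V, (MvPowerSeries.X (κ.1 a) : MvPowerSeries ℕ+ ℚ)) = _
  have hfin : {κ : {κ : G.V → ℕ+ // G.IsProper κ} | content κ.1 = m}.Finite :=
    (finite_content_eq m).preimage (Subtype.val_injective.injOn)
  have h1 : ∀ κ : {κ : G.V → ℕ+ // G.IsProper κ}, MvPowerSeries.coeff m
      (∏ a : G.V, (MvPowerSeries.X (κ.1 a) : MvPowerSeries ℕ+ ℚ)) =
      if κ ∈ {κ : {κ : G.V → ℕ+ // G.IsProper κ} | content κ.1 = m} then 1 else 0 := by
    intro κ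
    rw [prod_X_eq_monomial, MvPowerSeries.coeff_monomial]
    simp [eq_comm]
  rw [finsum_congr h1, finsum_eq_sum_of_support_subset (s := hfin.toFinset)]
  · rw [Finset.sum_congr rfl (g := fun _ => (1 : ℚ))]
    · rw [Finset.sum_const, nsmul_eq_mul, mul_one, count, ← Set.ncard_eq_toFinset_card _ hfin,
        ← Nat.card_coe_set_eq]
      congr 1
      exact Nat.card_congr
        (Equiv.subtypeSubtypeEquivSubtypeInter (fun κ : G.V → ℕ+ => G.IsProper κ)
          (fun κ => content κ = m))
    · intro κ hκ
      rw [if_pos (hfin.mem_toFinset.1 hκ)]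
  · intro κ hκ
    simpa using hκ

theorem isProper_sum_iff (c : EdgeColour) (G H : ECDigraph) (κ : G.V ⊕ H.V → ℕ+) :
    (sum c G H).IsProper κ ↔ G.IsProper (κ ∘ Sum.inl) ∧ H.IsProper (κ ∘ Sum.inr) ∧
      ∀ a b, (c = EdgeColour.dashed → κ (Sum.inl a) ≠ κ (Sum.inr b)) ∧
        (c = EdgeColour.solid → κ (Sum.inl a) < κ (Sum.inr b)) ∧
        (c = EdgeColour.double → κ (Sum.inl a) ≤ κ (Sum.inr b)) := by
  constructor
  · intro h
    refine ⟨fun a b => h (Sum.inl a) (Sum.inl b), fun a b => h (Sum.inr a) (Sum.inr b),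
      fun a b => ?_⟩
    have := h (Sum.inl a) (Sum.inr b)
    simpa [sum] using this
  · rintro ⟨h1, h2, h3⟩ (a | a) (b | b)
    · exact h1 a b
    · have := h3 a b
      simpa [sum] using this
    · simp [sum]
    · exact h2 a b

/-! ### Splitting exponent vectors at `r` -/

/-- The part of an exponent vector with exponents at least `r`. -/
noncomputable def large (r : ℕ∞) (m : ℕ+ →₀ ℕ) : ℕ+ →₀ ℕ :=
  haveI := Classical.decPred fun v => r ≤ (m v : ℕ∞)
  m.filter fun v => r ≤ (m v : ℕ∞)

/-- The part of an exponent vector with exponents smaller than `r`. -/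
noncomputable def small (r : ℕ∞) (m : ℕ+ →₀ ℕ) : ℕ+ →₀ ℕ :=
  haveI := Classical.decPred fun v => (m v : ℕ∞) < r
  m.filter fun v => (m v : ℕ∞) < r

theorem large_apply (r : ℕ∞) (m : ℕ+ →₀ ℕ) (v : ℕ+) [Decidable (r ≤ (m v : ℕ∞))] :
    large r m v = if r ≤ (m v : ℕ∞) then m v else 0 := by
  simp only [large, Finsupp.filter_apply]
  split_ifs <;> rfl

theorem small_apply (r : ℕ∞) (m : ℕ+ →₀ ℕ) (v : ℕ+) [Decidable ((m v : ℕ∞) < r)] :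
    small r m v = if (m v : ℕ∞) < r then m v else 0 := by
  simp only [small, Finsupp.filter_apply]
  split_ifs <;> rfl

theorem large_add_small (r : ℕ∞) (m : ℕ+ →₀ ℕ) : large r m + small r m = m := by
  classical
  ext v
  rw [Finsupp.add_apply, large_apply, small_apply]
  by_cases h : r ≤ (m v : ℕ∞)
  · simp [h, not_lt.2 h]
  · simp [h, not_le.1 h]

/-- With disjoint supports each value of `m` belongs entirely to one summand, and its comparison
with `r` tells to which. -/
theorem eq_large_small {r : ℕ∞} {m m₁ m₂ : ℕ+ →₀ ℕ} (h : m₁ + m₂ = m)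
    (hdisj : ∀ v, m₁ v = 0 ∨ m₂ v = 0) (h₁ : ∀ v, m₁ v ≠ 0 → r ≤ (m₁ v : ℕ∞))
    (h₂ : ∀ v, m₂ v ≠ 0 → (m₂ v : ℕ∞) < r) : m₁ = large r m ∧ m₂ = small r m := by
  classical
  subst h
  constructor <;> ext v
  · rw [large_apply, Finsupp.add_apply]
    have := h₁ v; have := h₂ v
    rcases hdisj v with h | h
    · by_cases h' : m₂ v = 0 <;> simp_all
    · by_cases h' : m₁ v = 0 <;> simp_all
  · rw [small_apply, Finsupp.add_apply]
    have := h₁ v; have := h₂ v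
    rcases hdisj v with h | h
    · by_cases h' : m₂ v = 0 <;> simp_all
    · by_cases h' : m₁ v = 0 <;> simp_all

/-- The colourings of a dashed sum split when the exponents of the first summand are large and
those of the second are small. -/
theorem count_sum_dashed {r : ℕ∞} (G H : ECDigraph)
    (hG : ∀ κ, G.IsProper κ → ∀ v, content κ v ≠ 0 → r ≤ (content κ v : ℕ∞))
    (hH : ∀ κ, H.IsProper κ → ∀ v, content κ v ≠ 0 → (content κ v : ℕ∞) < r)
    (m : ℕ+ →₀ ℕ) :
    (sum EdgeColour.dashed G H).count m = G.count (large r m) * H.count (small r m) := by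
  classical
  unfold count
  rw [← Nat.card_prod]
  have key : ∀ κ : G.V ⊕ H.V → ℕ+,
      ((sum EdgeColour.dashed G H).IsProper κ ∧ content κ = m) ↔
      (G.IsProper (κ ∘ Sum.inl) ∧ content (κ ∘ Sum.inl) = large r m) ∧
      (H.IsProper (κ ∘ Sum.inr) ∧ content (κ ∘ Sum.inr) = small r m) := by
    intro κ
    rw [isProper_sum_iff]
    constructor
    · rintro ⟨⟨h1, h2, h3⟩, h4⟩
      obtain ⟨h5, h6⟩ := eq_large_small (r := r) ((content_sumElim κ).symm.trans h4)
        -- A colour used in both summands would violate a dashed edge.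
        (fun v => by
          by_contra! hv
          obtain ⟨⟨a, ha⟩, ⟨b, hb⟩⟩ :=
            And.intro ((content_ne_zero_iff _ v).1 hv.1) ((content_ne_zero_iff _ v).1 hv.2)
          exact (h3 a b).1 rfl (ha.trans hb.symm))
        (hG _ h1) (hH _ h2)
      exact ⟨⟨h1, h5⟩, h2, h6⟩
    · rintro ⟨⟨h1, h5⟩, h2, h6⟩
      refine ⟨⟨h1, h2, fun a b => ⟨fun _ hab => ?_, by simp, by simp⟩⟩, ?_⟩
      -- Conversely, a colour common to both sides would have an exponent in `m` that is both at
      -- least `r` and smaller than `r`.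
      · have e1 := content_apply_ne_zero (κ ∘ Sum.inl) a
        have e2 := content_apply_ne_zero (κ ∘ Sum.inr) b
        rw [h5, large_apply] at e1
        rw [h6, small_apply] at e2
        simp only [Function.comp_apply, hab] at e1 e2
        split_ifs at e1 e2 with h7 h8
        · exact absurd h8 (not_lt.2 h7)
        all_goals simp_all
      · rw [content_sumElim, h5, h6, large_add_small]
  refine Nat.card_congr ⟨fun κ => (⟨κ.1 ∘ Sum.inl, ((key κ.1).1 κ.2).1⟩,
    ⟨κ.1 ∘ Sum.inr, ((key κ.1).1 κ.2).2⟩),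
    fun p => ⟨Sum.elim p.1.1 p.2.1, (key _).2 ⟨p.1.2, p.2.2⟩⟩, fun κ => ?_, fun p => ?_⟩
  · exact Subtype.ext (Sum.elim_comp_inl_inr κ.1)
  · rfl

end ECDigraph

/-! ### Colourings of sums of cycles -/

namespace EdgeColour

/-- The relation that an edge imposes on the colours of its ends. -/
def Rel : EdgeColour → ℕ+ → ℕ+ → Prop
  | dashed => (· ≠ ·)
  | solid => (· < ·)
  | double => (· ≤ ·)

end EdgeColour

namespace ECDigraph

/-- The weak inequalities along the cycle close up, so every colour equals that of vertex `0`. -/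
theorem isProper_cycle_iff (n : ℕ) (κ : Fin n → ℕ+) :
    (cycle n).IsProper κ ↔ ∀ a b, κ a = κ b := by
  constructor
  · intro h
    have hstep : ∀ a b : Fin n, (a.val + 1) % n = b.val → κ a ≤ κ b := by
      intro a b hab
      by_cases hne : a = b
      -- Only for `n = 1` is a vertex its own successor; no edge is needed there.
      · rw [hne]
      · exact (h a b).2.2 (if_pos ⟨hne, hab⟩)
    have h0 : ∀ (i : ℕ) (hi : i < n), κ ⟨0, by omega⟩ ≤ κ ⟨i, hi⟩ := by
      intro i
      induction i with
      | zero => exact fun _ => le_rfl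
      | succ i ih =>
        intro hi
        exact (ih (by omega)).trans (hstep _ _ (Nat.mod_eq_of_lt hi))
    have h1 : ∀ (d i : ℕ) (hi : i + d + 1 = n), κ ⟨i, by omega⟩ ≤ κ ⟨0, by omega⟩ := by
      intro d
      induction d with
      | zero =>
        intro i hi
        refine hstep _ _ ?_
        simp only
        rw [← hi]
        simp
      | succ d ih =>
        intro i hi
        exact (hstep _ ⟨i + 1, by omega⟩ (Nat.mod_eq_of_lt (by simp only; omega))).trans
          (ih (i + 1) (by omega))
    have h2 : ∀ a : Fin n, κ a = κ ⟨0, by have := a.2; omega⟩ := fun a =>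
      le_antisymm (h1 (n - 1 - a.1) a.1 (by have := a.2; omega)) (h0 a.1 a.2)
    intro a b
    rw [h2 a, h2 b]
  · intro h a b
    refine ⟨fun hab => ?_, fun hab => ?_, fun _ => (h a b).le⟩ <;>
    · simp only [cycle] at hab
      split_ifs at hab
      simp at hab

theorem isProper_sum_iff_rel (c : EdgeColour) (G H : ECDigraph) (κ : G.V ⊕ H.V → ℕ+) :
    (sum c G H).IsProper κ ↔ G.IsProper (κ ∘ Sum.inl) ∧ H.IsProper (κ ∘ Sum.inr) ∧
      ∀ a b, c.Rel (κ (Sum.inl a)) (κ (Sum.inr b)) := by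
  rw [isProper_sum_iff]
  cases c <;> simp [EdgeColour.Rel]

theorem surjective_of_fiber {V : Type} [Fintype V] {L : List ℕ} (hL : ∀ p ∈ L, 0 < p)
    {π : V → Fin L.length} (hπ : ∀ a, (∑ v, if π v = a then 1 else 0) = L.get a) :
    Function.Surjective π := by
  intro a
  by_contra! hne
  have h1 := hπ a
  simp only [hne, if_false, Finset.sum_const_zero] at h1
  exact (hL _ (List.get_mem L a)).ne h1

/-- The proper colourings of an iterated sum of cycles are constant on the cycles. -/
theorem exists_block_map (c : EdgeColour) (L : List ℕ) (hL : ∀ p ∈ L, 0 < p) :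
    ∃ π : (listSum c (L.map cycle)).V → Fin L.length,
      (∀ a, (∑ v, if π v = a then 1 else 0) = L.get a) ∧
      ∀ κ, (listSum c (L.map cycle)).IsProper κ ↔
        ∃ i : Fin L.length → ℕ+, (∀ a b, a < b → c.Rel (i a) (i b)) ∧ κ = i ∘ π := by
  induction L with
  | nil =>
    refine ⟨fun v => Empty.elim v, fun a => a.elim0, fun κ => ⟨fun _ =>
      ⟨fun a => a.elim0, fun a => a.elim0, funext fun v => Empty.elim v⟩,
      fun _ v => Empty.elim v⟩⟩
  | cons p t ih =>
    obtain ⟨π, hπ, hκ⟩ := ih fun q hq => hL q (List.mem_cons_of_mem _ hq)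
    have hp : 0 < p := hL p List.mem_cons_self
    have hsurj := surjective_of_fiber (fun q hq => hL q (List.mem_cons_of_mem _ hq)) hπ
    refine ⟨fun v => Sum.elim (fun _ : Fin p => (0 : Fin (t.length + 1)))
      (fun w => (π w).succ) v, fun a => ?_, fun κ => ?_⟩
    · refine (Fintype.sum_sum_type (α₁ := Fin p)
        (α₂ := (listSum c (t.map cycle)).V) (fun v => if Sum.elim
        (fun _ : Fin p => (0 : Fin (t.length + 1))) (fun w => (π w).succ) v = a
          then 1 else 0)).trans ?_
      refine Fin.cases ?_ (fun a => ?_) a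
      · simp
      · refine Eq.trans ?_ (hπ a)
        simp [(Fin.succ_ne_zero a).symm, Fin.succ_inj]
    · refine (isProper_sum_iff_rel c (cycle p) (listSum c (t.map cycle)) κ).trans ?_
      rw [hκ]
      constructor
      · rintro ⟨h1, ⟨i, hi, h2⟩, h3⟩
        replace h1 := (isProper_cycle_iff p _).1 h1
        -- As `p` is positive, vertex `0` is available to represent the first block. Surjectivity of
        -- `π` then gives the relation to every later block.
        refine ⟨Fin.cons (κ (Sum.inl (⟨0, hp⟩ : Fin p))) i, fun a b => ?_, ?_⟩
        · refine Fin.cases ?_ (fun a => ?_) a <;> refine Fin.cases ?_ (fun b => ?_) b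
          · intro h; exact absurd h (lt_irrefl _)
          · intro _
            obtain ⟨w, rfl⟩ := hsurj b
            have e : κ (Sum.inr w) = i (π w) := congrFun h2 w
            exact Eq.mp (congrArg (c.Rel _) e) (h3 (⟨0, hp⟩ : Fin p) w)
          · intro h; exact absurd h (Fin.not_lt_zero _)
          · intro h
            simpa using hi a b (Fin.succ_lt_succ_iff.1 h)
        · funext v
          rcases v with v | v
          · exact h1 v ⟨0, hp⟩
          · exact congrFun h2 v
      · rintro ⟨i, hi, rfl⟩
        refine ⟨?_, ⟨fun a => i a.succ, fun a b hab => hi _ _ (Fin.succ_lt_succ_iff.2 hab), rfl⟩,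
          fun a b => hi _ _ (Fin.succ_pos _)⟩
        exact (isProper_cycle_iff p _).2 fun _ _ => rfl

theorem content_comp_block {V : Type} [Fintype V] {k : ℕ} (π : V → Fin k) (e : Fin k → ℕ)
    (hπ : ∀ a, (∑ v, if π v = a then 1 else 0) = e a) (i : Fin k → ℕ+) :
    content (i ∘ π) = ∑ a, Finsupp.single (i a) (e a) := by
  have : ∀ v, Finsupp.single ((i ∘ π) v) 1 =
      ∑ a, if π v = a then Finsupp.single (i a) 1 else (0 : ℕ+ →₀ ℕ) := by
    intro v
    simp
  rw [content, Finset.sum_congr rfl fun v _ => this v, Finset.sum_comm]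
  refine Finset.sum_congr rfl fun a _ => ?_
  rw [← hπ a]
  ext w
  simp only [Finsupp.finsetSum_apply, Finsupp.single_apply]
  by_cases h : i a = w
  · simp only [h, if_true]
    refine Finset.sum_congr rfl fun v _ => ?_
    split_ifs <;> simp
  · simp only [h, if_false]
    refine Finset.sum_eq_zero fun v _ => ?_
    split_ifs <;> simp [h]

theorem prod_X_comp_block {V : Type} [Fintype V] {k : ℕ} (π : V → Fin k) (e : Fin k → ℕ)
    (hπ : ∀ a, (∑ v, if π v = a then 1 else 0) = e a) (i : Fin k → ℕ+) :
    ∏ v, (MvPowerSeries.X (i (π v)) : MvPowerSeries ℕ+ ℚ) =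
      ∏ a, (MvPowerSeries.X (i a) : MvPowerSeries ℕ+ ℚ) ^ e a := by
  classical
  rw [← Finset.prod_fiberwise_of_maps_to (s := Finset.univ) (t := Finset.univ) (g := π)
    (fun _ _ => Finset.mem_univ _)]
  refine Finset.prod_congr rfl fun a _ => ?_
  rw [Finset.prod_congr rfl (g := fun _ => (MvPowerSeries.X (i a) : MvPowerSeries ℕ+ ℚ)),
    Finset.prod_const]
  · congr 1
    rw [← hπ a, Finset.card_filter]
  · intro v hv
    rw [(Finset.mem_filter.1 hv).2]

theorem card_listSum_cycle (c : EdgeColour) (L : List ℕ) :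
    Fintype.card (listSum c (L.map cycle)).V = L.sum := by
  induction L with
  | nil => exact Fintype.card_eq_zero_iff.2 ⟨fun v => Empty.elim v⟩
  | cons p t ih =>
    rw [List.sum_cons, ← ih]
    refine (Fintype.card_sum (α := Fin p) (β := (listSum c (t.map cycle)).V)).trans ?_
    rw [Fintype.card_fin]

end ECDigraph

open ECDigraph in
/-- `M_{(β,μ)}` is a generalized chromatic function. -/
theorem RComposition.M_eq_chromaticFunction {r : ℕ∞} {n : ℕ} (c : RComposition r n) :
    c.M = c.digraphM.chromaticFunction := by
  obtain ⟨π₁, h₁, hκ₁⟩ := exists_block_map EdgeColour.solid c.β c.β_pos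
  obtain ⟨π₂, h₂, hκ₂⟩ := exists_block_map EdgeColour.dashed c.μ c.μ_pos
  have hs₁ := surjective_of_fiber c.β_pos h₁
  have hs₂ := surjective_of_fiber c.μ_pos h₂
  have hproper : ∀ κ, c.digraphM.IsProper κ ↔ ∃ i : DominantIndex c.β.length c.μ.length,
      κ = Sum.elim (i.1.1 ∘ π₁) (i.1.2 ∘ π₂) := by
    intro κ
    refine (isProper_sum_iff_rel _ _ _ κ).trans ?_
    rw [hκ₁, hκ₂]
    constructor
    · rintro ⟨⟨i, hi, hi'⟩, ⟨j, hj, hj'⟩, h⟩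
      refine ⟨⟨(i, j), fun a b => hi a b, ?_, ?_⟩, ?_⟩
      · intro a b hab
        rcases lt_trichotomy a b with hlt | heq | hlt
        · exact absurd hab (hj a b hlt)
        · exact heq
        · exact absurd hab.symm (hj b a hlt)
      · intro a b
        obtain ⟨v, rfl⟩ := hs₁ a
        obtain ⟨w, rfl⟩ := hs₂ b
        have := h v w
        rwa [show κ (Sum.inl v) = i (π₁ v) from congrFun hi' v,
          show κ (Sum.inr w) = j (π₂ w) from congrFun hj' w] at this
      · funext v
        rcases v with v | v
        · exact congrFun hi' v
        · exact congrFun hj' v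
    · rintro ⟨⟨⟨i, j⟩, hi, hj, hij⟩, rfl⟩
      exact ⟨⟨i, fun a b h => hi h, rfl⟩, ⟨j, fun a b h => hj.ne h.ne, rfl⟩, fun a b => hij _ _⟩
  have hbij : Function.Bijective (fun i : DominantIndex c.β.length c.μ.length =>
      (⟨Sum.elim (i.1.1 ∘ π₁) (i.1.2 ∘ π₂), (hproper _).2 ⟨i, rfl⟩⟩ :
        {κ : c.digraphM.V → ℕ+ // c.digraphM.IsProper κ})) := by
    constructor
    · intro i j hij
      have h := Subtype.ext_iff.1 hij
      refine Subtype.ext (Prod.ext (hs₁.injective_comp_right ?_) (hs₂.injective_comp_right ?_))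
      · exact funext fun v => congrFun h (Sum.inl v)
      · exact funext fun v => congrFun h (Sum.inr v)
    · rintro ⟨κ, hκ⟩
      obtain ⟨i, rfl⟩ := (hproper κ).1 hκ
      exact ⟨i, rfl⟩
  ext m
  refine finsum_eq_of_bijective _ hbij fun i => ?_
  refine congrArg (MvPowerSeries.coeff m) ?_
  refine (congrArg₂ (· * ·) (prod_X_comp_block π₁ _ h₁ _).symm
    (prod_X_comp_block π₂ _ h₂ _).symm).trans ?_
  exact (Fintype.prod_sum_type (α₁ := (listSum EdgeColour.solid (c.β.map cycle)).V)
    (α₂ := (listSum EdgeColour.dashed (c.μ.map cycle)).V) (fun v => (MvPowerSeries.X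
      (Sum.elim (i.1.1 ∘ π₁) (i.1.2 ∘ π₂) v) : MvPowerSeries ℕ+ ℚ))).symm

/-! ### Exponent vectors and their lists of exponents -/

/-- The exponent vector of `∏ x_{f(a)}^{L_a}`. -/
noncomputable def expVec (L : List ℕ) (f : Fin L.length → ℕ+) : ℕ+ →₀ ℕ :=
  ∑ a, Finsupp.single (f a) (L.get a)

theorem expVec_eq_mapDomain (L : List ℕ) {α : Type} (f : Fin L.length → α) (g : α → ℕ+) :
    expVec L (g ∘ f) = (∑ a, Finsupp.single (f a) (L.get a)).mapDomain g := by
  simp [expVec, Finsupp.mapDomain_finsetSum, Finsupp.mapDomain_single]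

theorem expVec_apply {L : List ℕ} {f : Fin L.length → ℕ+} (hf : Function.Injective f)
    (a : Fin L.length) : expVec L f (f a) = L.get a := by
  simp [expVec, Finsupp.finsetSum_apply, Finsupp.single_apply, hf.eq_iff]

theorem expVec_apply_of_notMem {L : List ℕ} {f : Fin L.length → ℕ+} {v : ℕ+}
    (hv : ∀ a, f a ≠ v) : expVec L f v = 0 := by
  simp [expVec, Finsupp.finsetSum_apply, hv]

theorem mem_support_expVec {L : List ℕ} (hL : ∀ p ∈ L, 0 < p) {f : Fin L.length → ℕ+}
    (hf : Function.Injective f) (v : ℕ+) : v ∈ (expVec L f).support ↔ ∃ a, f a = v := by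
  rw [Finsupp.mem_support_iff]
  constructor
  · intro h
    by_contra! hne
    exact h (expVec_apply_of_notMem hne)
  · rintro ⟨a, rfl⟩
    rw [expVec_apply hf]
    exact (hL _ (List.get_mem _ _)).ne'

theorem degree_expVec (L : List ℕ) (f : Fin L.length → ℕ+) : (expVec L f).degree = L.sum := by
  rw [expVec, map_sum]
  simp only [Finsupp.degree_single]
  rw [← List.sum_ofFn, List.ofFn_get]

/-- Shared by `flat` and `sorted`, which enumerate the support in different orders. The cast only
identifies the lengths of `S` and `S.map m`. -/
theorem expVec_of_list (m : ℕ+ →₀ ℕ) (S : List ℕ+) (hS : S.Nodup)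
    (hmem : ∀ v, v ∈ S ↔ v ∈ m.support) (f : Fin (S.map m).length → ℕ+)
    (hf : ∀ a, f a = S.get (a.cast (by simp))) : m = expVec (S.map m) f := by
  have hinj : Function.Injective f := by
    intro a b hab
    rw [hf, hf] at hab
    simpa [Fin.ext_iff] using List.nodup_iff_injective_get.1 hS hab
  ext v
  by_cases hv : ∃ a, f a = v
  · obtain ⟨a, rfl⟩ := hv
    rw [expVec_apply hinj, hf]
    simp
  · rw [expVec_apply_of_notMem (by simpa using hv)]
    by_contra hne
    obtain ⟨i, hi⟩ := List.get_of_mem ((hmem v).2 (Finsupp.mem_support_iff.2 hne))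
    exact hv ⟨i.cast (by simp), by rw [hf]; simpa using hi⟩

theorem support_perm_ofFn {L : List ℕ} (hL : ∀ p ∈ L, 0 < p) {f : Fin L.length → ℕ+}
    (hf : Function.Injective f) {S : List ℕ+} (hS : S.Nodup)
    (hmem : ∀ v, v ∈ S ↔ v ∈ (expVec L f).support) : S.Perm (List.ofFn f) := by
  rw [List.perm_ext_iff_of_nodup hS (List.nodup_ofFn.2 hf)]
  intro v
  rw [hmem, mem_support_expVec hL hf, List.mem_ofFn]

theorem map_ofFn_expVec {L : List ℕ} {f : Fin L.length → ℕ+} (hf : Function.Injective f) :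
    (List.ofFn f).map (expVec L f) = L := by
  rw [List.map_ofFn]
  conv_rhs => rw [← List.ofFn_get L]
  congr 1
  funext a
  exact expVec_apply hf a

/-- The list of the nonzero exponents, in the order of the variables. -/
noncomputable def flat (m : ℕ+ →₀ ℕ) : List ℕ :=
  (m.support.sort (· ≤ ·)).map m

/-- The nonzero exponents in decreasing order. -/
noncomputable def sorted (m : ℕ+ →₀ ℕ) : List ℕ :=
  (m.support.toList.insertionSort fun a b => m b ≤ m a).map m

theorem flat_expVec {L : List ℕ} (hL : ∀ p ∈ L, 0 < p) {f : Fin L.length → ℕ+}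
    (hf : StrictMono f) : flat (expVec L f) = L := by
  have h : (expVec L f).support.sort (· ≤ ·) = List.ofFn f := by
    refine (support_perm_ofFn hL hf.injective (Finset.sort_nodup _ _) (by simp)).eq_of_pairwise'
      (Finset.pairwise_sort _ _) ?_
    rw [List.pairwise_ofFn]
    exact fun i j hij => (hf hij).le
  rw [flat, h, map_ofFn_expVec hf.injective]

theorem exists_flat (m : ℕ+ →₀ ℕ) :
    ∃ f : Fin (flat m).length → ℕ+, StrictMono f ∧ m = expVec (flat m) f := by
  refine ⟨fun a => (m.support.sort (· ≤ ·)).get (a.cast (by simp [flat])), fun a b hab => ?_,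
    expVec_of_list m _ (Finset.sort_nodup _ _) (by simp) _ fun _ => rfl⟩
  exact (Finset.sortedLT_sort m.support).strictMono_get hab

theorem flat_pos (m : ℕ+ →₀ ℕ) : ∀ p ∈ flat m, 0 < p := by
  intro p hp
  simp only [flat, List.mem_map, Finset.mem_sort, Finsupp.mem_support_iff] at hp
  obtain ⟨v, hv, rfl⟩ := hp
  exact Nat.pos_of_ne_zero hv

theorem mem_flat {m : ℕ+ →₀ ℕ} {p : ℕ} (hp : p ∈ flat m) : ∃ v, m v = p ∧ m v ≠ 0 := by
  simp only [flat, List.mem_map, Finset.mem_sort, Finsupp.mem_support_iff] at hp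
  obtain ⟨v, hv, rfl⟩ := hp
  exact ⟨v, rfl, hv⟩

theorem mem_sorted {m : ℕ+ →₀ ℕ} {p : ℕ} (hp : p ∈ sorted m) : ∃ v, m v = p ∧ m v ≠ 0 := by
  simp only [sorted, List.mem_map, List.mem_insertionSort, Finset.mem_toList,
    Finsupp.mem_support_iff] at hp
  obtain ⟨v, hv, rfl⟩ := hp
  exact ⟨v, rfl, hv⟩

theorem sorted_pos (m : ℕ+ →₀ ℕ) : ∀ p ∈ sorted m, 0 < p := by
  intro p hp
  obtain ⟨v, rfl, hv⟩ := mem_sorted hp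
  exact Nat.pos_of_ne_zero hv

theorem pairwise_sorted (m : ℕ+ →₀ ℕ) : (sorted m).Pairwise fun p q => q ≤ p := by
  rw [sorted, List.pairwise_map]
  have : Std.Total fun a b : ℕ+ => m b ≤ m a := ⟨fun a b => le_total (m b) (m a)⟩
  have : IsTrans ℕ+ fun a b : ℕ+ => m b ≤ m a := ⟨fun a b c h1 h2 => h2.trans h1⟩
  exact List.pairwise_insertionSort (fun a b : ℕ+ => m b ≤ m a) m.support.toList

/-- Equal exponents leave the order of the variables undetermined. The comparison is therefore made
on the lists of values, where the order is antisymmetric and a sorted rearrangement is unique. -/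
theorem sorted_expVec {L : List ℕ} (hL : ∀ p ∈ L, 0 < p) (hdec : L.Pairwise fun p q => q ≤ p)
    {f : Fin L.length → ℕ+} (hf : Function.Injective f) : sorted (expVec L f) = L := by
  have h := (support_perm_ofFn hL hf
    (((List.perm_insertionSort (fun a b => expVec L f b ≤ expVec L f a)
      (expVec L f).support.toList).nodup_iff).2 (Finset.nodup_toList _))
    (by simp)).map (expVec L f)
  rw [map_ofFn_expVec hf] at h
  have : Std.Antisymm fun p q : ℕ => q ≤ p := ⟨fun a b h1 h2 => le_antisymm h2 h1⟩
  exact h.eq_of_pairwise' (pairwise_sorted _) hdec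

theorem exists_sorted (m : ℕ+ →₀ ℕ) :
    ∃ f : Fin (sorted m).length → ℕ+, Function.Injective f ∧ m = expVec (sorted m) f := by
  have hnd : (m.support.toList.insertionSort fun a b => m b ≤ m a).Nodup :=
    ((List.perm_insertionSort (fun a b => m b ≤ m a) m.support.toList).nodup_iff).2
      (Finset.nodup_toList _)
  refine ⟨fun a => (m.support.toList.insertionSort fun a b => m b ≤ m a).get
    (a.cast (by simp [sorted])), fun a b hab => ?_,
    expVec_of_list m _ hnd (by simp) _ fun _ => rfl⟩
  simpa [Fin.ext_iff] using List.nodup_iff_injective_get.1 hnd hab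

theorem degree_eq_sum_flat (m : ℕ+ →₀ ℕ) : m.degree = (flat m).sum := by
  obtain ⟨f, _, h⟩ := exists_flat m
  conv_lhs => rw [h]
  exact degree_expVec _ _

theorem degree_eq_sum_sorted (m : ℕ+ →₀ ℕ) : m.degree = (sorted m).sum := by
  obtain ⟨f, _, h⟩ := exists_sorted m
  conv_lhs => rw [h]
  exact degree_expVec _ _

/-! ### Symmetry and quasisymmetry of the counts -/

/-- A function of exponent vectors that is invariant under exchanges of neighbouring variables
depends only on the multiset of exponents. -/
theorem eq_of_sorted_eq {F : (ℕ+ →₀ ℕ) → ℕ}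
    (hF : ∀ (m : ℕ+ →₀ ℕ) (u : ℕ),
      F (m.mapDomain (Equiv.swap u.succPNat (u + 1).succPNat)) = F m)
    {m m' : ℕ+ →₀ ℕ} (h : sorted m = sorted m') : F m = F m' := by
  obtain ⟨f, hf, hm⟩ := exists_sorted m
  obtain ⟨g, hg, hm'⟩ := exists_sorted m'
  rw [hm, hm']
  clear hm hm'
  generalize sorted m = L at *
  generalize sorted m' = L' at *
  subst h
  -- All variables involved lie in a finite initial segment, so a finite symmetric group, generated
  -- by adjacent transpositions, suffices.
  obtain ⟨N, hN⟩ : ∃ N : ℕ, ∀ a, (f a : ℕ) ≤ N ∧ (g a : ℕ) ≤ N := by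
    refine ⟨∑ a, ((f a : ℕ) + g a), fun a => ?_⟩
    have := Finset.single_le_sum (f := fun a => (f a : ℕ) + g a) (fun _ _ => Nat.zero_le _)
      (Finset.mem_univ a)
    omega
  let ι : Fin (N + 1) → ℕ+ := fun i => i.1.succPNat
  have hlift : ∀ k : Fin L.length → ℕ+, (∀ a, (k a : ℕ) ≤ N) → Function.Injective k →
      ∃ k' : Fin L.length → Fin (N + 1), Function.Injective k' ∧ k = ι ∘ k' := by
    intro k hk hinj
    have e : k = ι ∘ fun a => ⟨(k a).natPred, by
        have h1 := (k a).natPred_add_one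
        have h2 := hk a
        omega⟩ := by
      funext a
      simp [ι]
    refine ⟨_, ?_, e⟩
    intro a b hab
    apply hinj
    rw [e]
    exact congrArg ι hab
  obtain ⟨f', hf', rfl⟩ := hlift f (fun a => (hN a).1) hf
  obtain ⟨g', hg', rfl⟩ := hlift g (fun a => (hN a).2) hg
  -- Some permutation carries the variables `f'` to `g'` position by position.
  obtain ⟨σ, hσ⟩ := Equiv.Perm.exists_extending_pair f' g' hf' hg'
  have key : ∀ x : Fin (N + 1) →₀ ℕ, F ((x.mapDomain σ).mapDomain ι) = F (x.mapDomain ι) := by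
    have hmem : σ ∈ Submonoid.closure
        (Set.range fun i : Fin N => Equiv.swap i.castSucc i.succ) := by
      rw [Equiv.Perm.mclosure_swap_castSucc_succ]
      trivial
    clear hσ
    induction hmem using Submonoid.closure_induction with
    | mem σ h =>
      obtain ⟨i, rfl⟩ := h
      intro x
      rw [← hF (x.mapDomain ι) i.1, ← Finsupp.mapDomain_comp, ← Finsupp.mapDomain_comp]
      congr 2
      funext j
      have hι : Function.Injective ι := fun a b hab => Fin.ext (Nat.succPNat_injective hab)
      exact (hι.swap_apply i.castSucc i.succ j).symm
    | one => intro x; simp [Finsupp.mapDomain_id]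
    | mul σ τ _ _ h1 h2 =>
      intro x
      rw [Equiv.Perm.coe_mul, Finsupp.mapDomain_comp, h1, h2]
  have hg'' : g' = σ ∘ f' := (funext hσ).symm
  rw [hg'', expVec_eq_mapDomain, expVec_eq_mapDomain, ← key]
  congr 2
  simp [Finsupp.mapDomain_finsetSum, Finsupp.mapDomain_single]

namespace ECDigraph

theorem isProper_comp_iff (G : ECDigraph) {α : Type} [LinearOrder α] (j : G.V → α)
    {f g : α → ℕ+} (hf : StrictMono f) (hg : StrictMono g) :
    G.IsProper (f ∘ j) ↔ G.IsProper (g ∘ j) := by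
  simp [IsProper, hf.lt_iff_lt, hf.le_iff_le, hg.lt_iff_lt, hg.le_iff_le, hf.injective.eq_iff,
    hg.injective.eq_iff]

/-- The chromatic function is quasisymmetric. -/
theorem count_eq_of_flat_eq (G : ECDigraph) {m m' : ℕ+ →₀ ℕ} (h : flat m = flat m') :
    G.count m = G.count m' := by
  obtain ⟨f, hf, hm⟩ := exists_flat m
  obtain ⟨g, hg, hm'⟩ := exists_flat m'
  have hpos := flat_pos m
  rw [hm, hm']
  clear hm hm'
  generalize flat m = L at *
  generalize flat m' = L' at *
  subst h
  let s : Fin L.length → ℕ+ := fun a => a.1.succPNat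
  have hs : StrictMono s := fun a b hab => Nat.succPNat_strictMono hab
  -- Only the relative order of the colours matters, so colourings are counted with colours in `Fin
  -- L.length`. The map `s` is an arbitrary increasing embedding that makes properness meaningful
  -- there, and the count no longer mentions `f`.
  suffices key : ∀ f : Fin L.length → ℕ+, StrictMono f → G.count (expVec L f) =
      Nat.card {j : G.V → Fin L.length // G.IsProper (s ∘ j) ∧
        ∑ v, Finsupp.single (j v) 1 = ∑ a, Finsupp.single a (L.get a)} by
    rw [key f hf, key g hg]
  intro f hf
  have hcontent : ∀ j : G.V → Fin L.length, content (f ∘ j) = expVec L f ↔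
      ∑ v, Finsupp.single (j v) 1 = ∑ a, Finsupp.single a (L.get a) := by
    intro j
    have e := expVec_eq_mapDomain L id f
    rw [Function.comp_id] at e
    rw [e, ← (Finsupp.mapDomain_injective hf.injective).eq_iff]
    simp [content, Finsupp.mapDomain_finsetSum, Finsupp.mapDomain_single]
  refine (Nat.card_congr (Equiv.ofBijective (fun j => ⟨f ∘ j.1,
    (G.isProper_comp_iff j.1 hs hf).1 j.2.1, (hcontent j.1).2 j.2.2⟩) ⟨?_, ?_⟩)).symm
  · intro i j hij
    exact Subtype.ext (hf.injective.comp_left (Subtype.ext_iff.1 hij))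
  · rintro ⟨κ, hκ, hκ'⟩
    have : ∀ v, ∃ a, f a = κ v := by
      intro v
      rw [← mem_support_expVec hpos hf.injective, ← hκ', Finsupp.mem_support_iff]
      exact content_apply_ne_zero κ v
    choose j hj using this
    obtain rfl : f ∘ j = κ := funext hj
    exact ⟨⟨j, (G.isProper_comp_iff j hs hf).2 hκ, (hcontent j).1 hκ'⟩, rfl⟩

end ECDigraph

/-! ### The digraphs for `β` and for `μ`: what the basis proof needs -/

namespace ECDigraph

/-- The properties of the digraphs for `β` used in the proof that the four families are bases. -/
structure CompositionLike (r : ℕ∞) (β : List ℕ) (P : ECDigraph) : Prop where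
  le_content : ∀ κ, P.IsProper κ → ∀ v, content κ v ≠ 0 → r ≤ (content κ v : ℕ∞)
  card_eq : Fintype.card P.V = β.sum
  flat_of_count : ∀ m, P.count m ≠ 0 → flat m = β ∨ (flat m).length < β.length
  count_of_flat : ∀ m, flat m = β → P.count m ≠ 0

/-- The properties of the digraphs for `μ` used in the proof that the four families are bases. -/
structure PartitionLike (r : ℕ∞) (μ : List ℕ) (Q : ECDigraph) : Prop where
  content_lt : ∀ κ, Q.IsProper κ → ∀ v, content κ v ≠ 0 → (content κ v : ℕ∞) < r
  card_eq : Fintype.card Q.V = μ.sum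
  sorted_of_count : ∀ m, Q.count m ≠ 0 → sorted m ≤ μ
  count_of_sorted : ∀ m, sorted m = μ → Q.count m ≠ 0
  count_eq : ∀ m m', sorted m = sorted m' → Q.count m = Q.count m'

theorem _root_.expVec_apply_eq_sum (L : List ℕ) (f : Fin L.length → ℕ+) (v : ℕ+) :
    expVec L f v = ∑ a, if f a = v then L.get a else 0 := by
  simp [expVec, Finsupp.finsetSum_apply, Finsupp.single_apply]

/-- The proper colourings of an iterated sum of cycles. -/
theorem exists_proper_listSum_iff (c : EdgeColour) {L : List ℕ} (hL : ∀ p ∈ L, 0 < p)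
    (m : ℕ+ →₀ ℕ) :
    (listSum c (L.map cycle)).count m ≠ 0 ↔
      ∃ i : Fin L.length → ℕ+, (∀ a b, a < b → c.Rel (i a) (i b)) ∧ expVec L i = m := by
  obtain ⟨π, hπ, h⟩ := exists_block_map c L hL
  rw [count_ne_zero_iff]
  constructor
  · rintro ⟨κ, hκ, rfl⟩
    obtain ⟨i, hi, rfl⟩ := (h κ).1 hκ
    exact ⟨i, hi, (content_comp_block π _ hπ i).symm⟩
  · rintro ⟨i, hi, rfl⟩
    exact ⟨i ∘ π, (h _).2 ⟨i, hi, rfl⟩, content_comp_block π _ hπ i⟩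

theorem count_content_ne_zero {G : ECDigraph} {κ : G.V → ℕ+} (hκ : G.IsProper κ) :
    G.count (content κ) ≠ 0 :=
  (G.count_ne_zero_iff _).2 ⟨κ, hκ, rfl⟩

/-- Each nonzero exponent is a sum of parts of `L` with at least one term, and a single part already
reaches `r`. -/
theorem le_content_listSum (c : EdgeColour) {r : ℕ∞} {L : List ℕ} (hL : ∀ p ∈ L, 0 < p)
    (hr : ∀ p ∈ L, r ≤ (p : ℕ∞)) (κ : (listSum c (L.map cycle)).V → ℕ+)
    (hκ : (listSum c (L.map cycle)).IsProper κ) (v : ℕ+) (hv : content κ v ≠ 0) :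
    r ≤ (content κ v : ℕ∞) := by
  obtain ⟨i, -, hi⟩ := (exists_proper_listSum_iff c hL _).1 (count_content_ne_zero hκ)
  rw [← hi, expVec_apply_eq_sum] at hv ⊢
  obtain ⟨a, -, ha⟩ := Finset.exists_ne_zero_of_sum_ne_zero hv
  refine (hr _ (List.get_mem L a)).trans (Nat.cast_le.2 ?_)
  refine le_trans ?_ (Finset.single_le_sum (fun _ _ => Nat.zero_le _) (Finset.mem_univ a))
  split_ifs at ha ⊢
  · exact le_rfl
  · exact absurd rfl ha

theorem flat_of_count_solid {β : List ℕ} (hβ : ∀ p ∈ β, 0 < p) {m : ℕ+ →₀ ℕ}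
    (hm : (listSum EdgeColour.solid (β.map cycle)).count m ≠ 0) : flat m = β := by
  obtain ⟨i, hi, rfl⟩ := (exists_proper_listSum_iff _ hβ m).1 hm
  exact flat_expVec hβ fun a b h => hi a b h

theorem compositionLike_solid {r : ℕ∞} {β : List ℕ} (hβ : ∀ p ∈ β, 0 < p)
    (hr : ∀ p ∈ β, r ≤ (p : ℕ∞)) :
    CompositionLike r β (listSum EdgeColour.solid (β.map cycle)) where
  le_content := le_content_listSum _ hβ hr
  card_eq := card_listSum_cycle _ _
  flat_of_count m hm := Or.inl (flat_of_count_solid hβ hm)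
  count_of_flat m hm := by
    obtain ⟨f, hf, h⟩ := exists_flat m
    subst hm
    exact (exists_proper_listSum_iff _ hβ m).2 ⟨f, fun a b hab => hf hab, h.symm⟩

theorem length_flat (m : ℕ+ →₀ ℕ) : (flat m).length = m.support.card := by
  simp [flat]

theorem compositionLike_double {r : ℕ∞} {β : List ℕ} (hβ : ∀ p ∈ β, 0 < p)
    (hr : ∀ p ∈ β, r ≤ (p : ℕ∞)) :
    CompositionLike r β (listSum EdgeColour.double (β.map cycle)) where
  le_content := le_content_listSum _ hβ hr
  card_eq := card_listSum_cycle _ _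
  flat_of_count m hm := by
    obtain ⟨i, hi, rfl⟩ := (exists_proper_listSum_iff _ hβ m).1 hm
    -- A weakly increasing injective colouring is strictly increasing and gives `β`; any other one
    -- merges blocks and uses fewer colours.
    by_cases hinj : Function.Injective i
    · exact Or.inl (flat_expVec hβ fun a b h => lt_of_le_of_ne (hi a b h) (hinj.ne h.ne))
    · right
      rw [length_flat]
      have h1 : (expVec β i).support ⊆ Finset.univ.image i := by
        intro v hv
        by_contra hne
        exact (Finsupp.mem_support_iff.1 hv) (expVec_apply_of_notMem (by simpa using hne))
      refine (Finset.card_le_card h1).trans_lt ?_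
      refine lt_of_le_of_ne (Finset.card_image_le.trans_eq (Finset.card_fin _)) fun h => hinj ?_
      rw [← Set.injOn_univ, ← Finset.coe_univ, ← Finset.card_image_iff, h, Finset.card_fin]
  count_of_flat m hm := by
    obtain ⟨f, hf, h⟩ := exists_flat m
    subst hm
    exact (exists_proper_listSum_iff _ hβ m).2 ⟨f, fun a b hab => (hf hab).le, h.symm⟩

theorem injective_of_rel_dashed {k : ℕ} {i : Fin k → ℕ+}
    (hi : ∀ a b, a < b → EdgeColour.dashed.Rel (i a) (i b)) : Function.Injective i := by
  intro a b hab
  rcases lt_trichotomy a b with h | h | h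
  · exact absurd hab (hi a b h)
  · exact h
  · exact absurd hab.symm (hi b a h)

theorem sorted_of_count_dashed {μ : List ℕ} (hμ : ∀ p ∈ μ, 0 < p)
    (hdec : μ.Pairwise fun p q => q ≤ p) {m : ℕ+ →₀ ℕ}
    (hm : (listSum EdgeColour.dashed (μ.map cycle)).count m ≠ 0) : sorted m = μ := by
  obtain ⟨i, hi, rfl⟩ := (exists_proper_listSum_iff _ hμ m).1 hm
  exact sorted_expVec hμ hdec (injective_of_rel_dashed hi)

theorem content_comp {V : Type} [Fintype V] (κ : V → ℕ+) (σ : ℕ+ → ℕ+) :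
    content (σ ∘ κ) = (content κ).mapDomain σ := by
  simp [content, Finsupp.mapDomain_finsetSum, Finsupp.mapDomain_single]

/-- Between blocks only inequality of colours is required, and this survives any permutation of the
colours. -/
theorem count_mapDomain_dashed {μ : List ℕ} (hμ : ∀ p ∈ μ, 0 < p) (σ : Equiv.Perm ℕ+)
    (m : ℕ+ →₀ ℕ) : (listSum EdgeColour.dashed (μ.map cycle)).count (m.mapDomain σ) =
      (listSum EdgeColour.dashed (μ.map cycle)).count m := by
  obtain ⟨π, -, h⟩ := exists_block_map EdgeColour.dashed μ hμ
  have h1 : ∀ (τ : Equiv.Perm ℕ+) κ, (listSum EdgeColour.dashed (μ.map cycle)).IsProper κ →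
      (listSum EdgeColour.dashed (μ.map cycle)).IsProper (τ ∘ κ) := by
    intro τ κ hκ
    obtain ⟨i, hi, rfl⟩ := (h κ).1 hκ
    exact (h _).2 ⟨τ ∘ i, fun a b hab => τ.injective.ne (hi a b hab), rfl⟩
  refine (Nat.card_congr ((Equiv.arrowCongr (Equiv.refl _) σ).subtypeEquiv fun κ => ?_)).symm
  change _ ↔ IsProper _ (σ ∘ κ) ∧ content (σ ∘ κ) = _
  rw [content_comp, (Finsupp.mapDomain_injective σ.injective).eq_iff]
  refine and_congr_left fun _ => ⟨h1 σ κ, fun hκ => ?_⟩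
  have := h1 σ.symm _ hκ
  rwa [← Function.comp_assoc, Equiv.symm_comp_self, Function.id_comp] at this

theorem partitionLike_dashed {r : ℕ∞} {μ : List ℕ} (hμ : ∀ p ∈ μ, 0 < p)
    (hdec : μ.Pairwise fun p q => q ≤ p) (hr : ∀ p ∈ μ, (p : ℕ∞) < r) :
    PartitionLike r μ (listSum EdgeColour.dashed (μ.map cycle)) where
  content_lt κ hκ v hv := by
    obtain ⟨i, hi, h⟩ := (exists_proper_listSum_iff _ hμ _).1 (count_content_ne_zero hκ)
    rw [← h] at hv ⊢
    have hinj := injective_of_rel_dashed hi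
    obtain ⟨a, rfl⟩ := (mem_support_expVec hμ hinj v).1 (Finsupp.mem_support_iff.2 hv)
    rw [expVec_apply hinj]
    exact hr _ (List.get_mem _ _)
  card_eq := card_listSum_cycle _ _
  sorted_of_count m hm := (sorted_of_count_dashed hμ hdec hm).le
  count_of_sorted m hm := by
    obtain ⟨f, hf, h⟩ := exists_sorted m
    subst hm
    exact (exists_proper_listSum_iff _ hμ m).2 ⟨f, fun a b hab => hf.ne hab.ne, h.symm⟩
  count_eq m m' h := eq_of_sorted_eq (fun m u => count_mapDomain_dashed hμ _ m) h

end ECDigraph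

/-! ### Gelfand–Tsetlin patterns and the Bender–Knuth involution -/

/-- `L i v` is the number of entries at most `v` in row `i` of a semistandard tableau of shape `μ`:
the conditions of a Gelfand–Tsetlin pattern. -/
structure IsPattern (μ : List ℕ) (L : ℕ → ℕ → ℕ) : Prop where
  zero : ∀ i, L i 0 = 0
  mono : ∀ i v, L i v ≤ L i (v + 1)
  interlace : ∀ i v, L (i + 1) (v + 1) ≤ L i v
  stable : ∃ N, ∀ v, N ≤ v → ∀ i, L i v = μ.getD i 0

namespace IsPattern

variable {μ : List ℕ} {L : ℕ → ℕ → ℕ}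

theorem monotone (h : IsPattern μ L) (i : ℕ) : Monotone (L i) :=
  monotone_nat_of_le_succ (h.mono i)

theorem le_getD (h : IsPattern μ L) (i v : ℕ) : L i v ≤ μ.getD i 0 := by
  obtain ⟨N, hN⟩ := h.stable
  rw [← hN (max N v) (le_max_left _ _) i]
  exact h.monotone i (le_max_right _ _)

theorem eq_zero (h : IsPattern μ L) {i : ℕ} (hi : μ.length ≤ i) (v : ℕ) : L i v = 0 := by
  have := h.le_getD i v
  rw [List.getD_eq_default _ _ hi] at this
  omega

/-- The least possible entry of a pattern, given its neighbours. -/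
def lower (L : ℕ → ℕ → ℕ) (u i : ℕ) : ℕ := max (L (i + 1) (u + 2)) (L i u)

/-- The largest possible entry of a pattern, given its neighbours. -/
def upper (L : ℕ → ℕ → ℕ) (u : ℕ) : ℕ → ℕ
  | 0 => L 0 (u + 2)
  | i + 1 => min (L (i + 1) (u + 2)) (L i u)

/-- The Bender–Knuth involution: reflect the entries at `u + 1` in the intervals of the values that
their neighbours allow. -/
def reflect (L : ℕ → ℕ → ℕ) (u i v : ℕ) : ℕ :=
  if v = u + 1 then lower L u i + upper L u i - L i (u + 1) else L i v

theorem lower_le (h : IsPattern μ L) (u i : ℕ) : lower L u i ≤ L i (u + 1) :=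
  max_le (h.interlace i (u + 1)) (h.mono i u)

theorem le_upper (h : IsPattern μ L) (u i : ℕ) : L i (u + 1) ≤ upper L u i := by
  cases i with
  | zero => exact h.mono 0 (u + 1)
  | succ i => exact le_min (h.mono _ _) (h.interlace i u)

theorem upper_le (u i : ℕ) : upper L u i ≤ L i (u + 2) := by
  cases i with
  | zero => exact le_rfl
  | succ i => exact min_le_left _ _

/-- The lower bound in row `n` and the upper bound in row `n + 1` are the maximum and the minimum of
the same two entries, so the sum regroups into plain row entries. -/
theorem sum_lower_add_upper (L : ℕ → ℕ → ℕ) (u n : ℕ) :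
    ∑ i ∈ Finset.range n, (lower L u i + upper L u i) + upper L u n =
      ∑ i ∈ Finset.range n, L i u + ∑ i ∈ Finset.range (n + 1), L i (u + 2) := by
  induction n with
  | zero => simp [upper]
  | succ n ih =>
    rw [Finset.sum_range_succ, Finset.sum_range_succ _ (n + 1), Finset.sum_range_succ _ n]
    have : lower L u n + upper L u (n + 1) = L (n + 1) (u + 2) + L n u := max_add_min _ _
    omega

theorem lower_le_reflect (h : IsPattern μ L) (u i : ℕ) :
    lower L u i ≤ reflect L u i (u + 1) := by
  have h1 := h.le_upper u i
  rw [reflect, if_pos rfl]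
  omega

theorem reflect_le_upper (h : IsPattern μ L) (u i : ℕ) :
    reflect L u i (u + 1) ≤ upper L u i := by
  have h1 := h.lower_le u i
  rw [reflect, if_pos rfl]
  omega

theorem reflect_of_ne (L : ℕ → ℕ → ℕ) {u v : ℕ} (i : ℕ) (hv : v ≠ u + 1) :
    reflect L u i v = L i v := if_neg hv

/-- The conditions on an entry at level `u + 1` say that it lies between `lower` and `upper`. These
bounds involve only the levels `u` and `u + 2`, so all rows can be reflected independently. -/
theorem isPattern_reflect (h : IsPattern μ L) (u : ℕ) : IsPattern μ (reflect L u) where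
  zero i := by rw [reflect_of_ne L i (by omega), h.zero]
  mono i v := by
    by_cases h1 : v = u + 1
    · subst h1
      rw [reflect_of_ne L i (v := u + 1 + 1) (by omega)]
      exact (h.reflect_le_upper u i).trans (upper_le u i)
    · by_cases h2 : v = u
      · subst h2
        rw [reflect_of_ne L i h1]
        exact (le_max_right _ _).trans (h.lower_le_reflect v i)
      · rw [reflect_of_ne L i h1, reflect_of_ne L i (by omega)]
        exact h.mono i v
  interlace i v := by
    by_cases h1 : v = u + 1
    · subst h1
      rw [reflect_of_ne L _ (v := u + 1 + 1) (by omega)]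
      exact (le_max_left _ _).trans (h.lower_le_reflect u i)
    · by_cases h2 : v = u
      · subst h2
        rw [reflect_of_ne L i h1]
        exact (h.reflect_le_upper v (i + 1)).trans (min_le_right _ _)
      · rw [reflect_of_ne L i h1, reflect_of_ne L _ (by omega)]
        exact h.interlace i v
  stable := by
    obtain ⟨N, hN⟩ := h.stable
    refine ⟨max N (u + 2), fun v hv i => ?_⟩
    have h1 := le_max_left N (u + 2)
    have h2 := le_max_right N (u + 2)
    rw [reflect_of_ne L i (by omega), hN v (by omega)]

theorem lower_reflect (L : ℕ → ℕ → ℕ) (u i : ℕ) : lower (reflect L u) u i = lower L u i := by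
  rw [lower, lower, reflect_of_ne L _ (by omega), reflect_of_ne L _ (by omega)]

theorem upper_reflect (L : ℕ → ℕ → ℕ) (u i : ℕ) : upper (reflect L u) u i = upper L u i := by
  cases i with
  | zero => exact reflect_of_ne L _ (by omega)
  | succ i =>
    rw [upper, upper, reflect_of_ne L _ (by omega), reflect_of_ne L _ (by omega)]

theorem reflect_reflect (h : IsPattern μ L) (u : ℕ) : reflect (reflect L u) u = L := by
  funext i v
  by_cases h1 : v = u + 1
  · subst h1
    have h2 := h.lower_le u i
    have h3 := h.le_upper u i
    rw [reflect, if_pos rfl, lower_reflect, upper_reflect, reflect, if_pos rfl]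
    omega
  · rw [reflect_of_ne _ _ h1, reflect_of_ne _ _ h1]

/-- The exponents are the differences of consecutive level sums. Replacing the middle sum by the sum
of its two neighbours minus itself exchanges two adjacent differences. -/
theorem sum_reflect (h : IsPattern μ L) (u : ℕ) :
    ∑ i ∈ Finset.range μ.length, reflect L u i (u + 1) +
      ∑ i ∈ Finset.range μ.length, L i (u + 1) =
    ∑ i ∈ Finset.range μ.length, L i u + ∑ i ∈ Finset.range μ.length, L i (u + 2) := by
  have h1 := sum_lower_add_upper L u μ.length
  -- The regrouped sum has no boundary term because the row below the shape is empty.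
  have h2 : upper L u μ.length = 0 :=
    Nat.eq_zero_of_le_zero ((upper_le u _).trans_eq (h.eq_zero le_rfl _))
  rw [h2, Finset.sum_range_succ, h.eq_zero le_rfl (u + 2), add_zero, add_zero] at h1
  rw [← h1, ← Finset.sum_add_distrib]
  refine Finset.sum_congr rfl fun i _ => ?_
  have h3 := h.lower_le u i
  rw [reflect, if_pos rfl]
  have h4 := h.le_upper u i
  omega

/-- The exponent vector of the tableau of a pattern is `m`. -/
def HasContent (μ : List ℕ) (L : ℕ → ℕ → ℕ) (m : ℕ+ →₀ ℕ) : Prop :=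
  ∀ v, ∑ i ∈ Finset.range μ.length, L i (v + 1) =
    ∑ i ∈ Finset.range μ.length, L i v + m v.succPNat

theorem hasContent_reflect (h : IsPattern μ L) {m : ℕ+ →₀ ℕ} (hm : HasContent μ L m) (u : ℕ) :
    HasContent μ (reflect L u)
      (m.mapDomain (Equiv.swap u.succPNat (u + 1).succPNat)) := by
  have hmap : ∀ w, m.mapDomain (Equiv.swap u.succPNat (u + 1).succPNat) w =
      m (Equiv.swap u.succPNat (u + 1).succPNat w) := by
    intro w
    conv_lhs => rw [← Equiv.swap_apply_self u.succPNat (u + 1).succPNat w]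
    exact Finsupp.mapDomain_apply (Equiv.injective _) _ _
  have h1 := h.sum_reflect u
  have h2 := hm u
  have h3 := hm (u + 1)
  intro v
  rw [hmap]
  by_cases e1 : v = u
  · subst e1
    rw [Equiv.swap_apply_left]
    simp only [reflect_of_ne L _ (show v ≠ v + 1 by omega)]
    simp only [show v + 1 + 1 = v + 2 from rfl] at h3
    omega
  · by_cases e2 : v = u + 1
    · subst e2
      rw [Equiv.swap_apply_right]
      simp only [reflect_of_ne L _ (show u + 1 + 1 ≠ u + 1 by omega)]
      simp only [show u + 1 + 1 = u + 2 from rfl] at h3 ⊢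
      omega
    · rw [Equiv.swap_apply_of_ne_of_ne (Nat.succPNat_injective.ne e1)
        (Nat.succPNat_injective.ne e2)]
      simp only [reflect_of_ne L _ e2, reflect_of_ne L _ (show v + 1 ≠ u + 1 by omega)]
      exact hm v

/-- The Bender–Knuth involution as a bijection. -/
theorem card_swap (μ : List ℕ) (m : ℕ+ →₀ ℕ) (u : ℕ) :
    Nat.card {L // IsPattern μ L ∧
      HasContent μ L (m.mapDomain (Equiv.swap u.succPNat (u + 1).succPNat))} =
    Nat.card {L // IsPattern μ L ∧ HasContent μ L m} := by
  refine Nat.card_congr ⟨fun L => ⟨reflect L.1 u, L.2.1.isPattern_reflect u, ?_⟩,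
    fun L => ⟨reflect L.1 u, L.2.1.isPattern_reflect u, L.2.1.hasContent_reflect L.2.2 u⟩,
    fun L => Subtype.ext (L.2.1.reflect_reflect u),
    fun L => Subtype.ext (L.2.1.reflect_reflect u)⟩
  have := L.2.1.hasContent_reflect L.2.2 u
  rwa [← Finsupp.mapDomain_comp, ← Equiv.coe_trans, Equiv.swap_swap, Equiv.coe_refl,
    Finsupp.mapDomain_id] at this

end IsPattern

/-- A bounded down-closed set of naturals is an initial segment, so membership is comparison with
its cardinality. It is applied to the cells of a row with colour at most `v`. -/
theorem lt_card_filter_range_iff {p : ℕ → Prop} [DecidablePred p] {B : ℕ}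
    (hp : ∀ j, p (j + 1) → p j) (hB : ∀ j, p j → j < B) (j : ℕ) :
    j < ((Finset.range B).filter p).card ↔ p j := by
  have hdown : ∀ d j, p (j + d) → p j := by
    intro d
    induction d with
    | zero => exact fun j h => h
    | succ d ih => exact fun j h => ih j (hp _ h)
  have hdown' : ∀ a b, a ≤ b → p b → p a := by
    intro a b hab h
    obtain ⟨d, rfl⟩ := Nat.exists_eq_add_of_le hab
    exact hdown d a h
  constructor
  · intro h
    by_contra hj
    refine absurd h (not_lt.2 ?_)
    refine (Finset.card_le_card (t := Finset.range j) fun a ha => ?_).trans_eq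
      (Finset.card_range j)
    rw [Finset.mem_range]
    by_contra hle
    exact hj (hdown' _ _ (not_lt.1 hle) (Finset.mem_filter.1 ha).2)
  · intro h
    refine (Finset.card_range (j + 1)).symm.le.trans (Finset.card_le_card fun a ha => ?_)
    have := hdown' a j (Nat.lt_succ_iff.1 (Finset.mem_range.1 ha)) h
    exact Finset.mem_filter.2 ⟨Finset.mem_range.2 (hB a this), this⟩

/-- Prefix sums compare lists lexicographically. -/
theorem le_of_prefix_sums {ν μ : List ℕ} (hν : ∀ p ∈ ν, 0 < p)
    (h : ∀ v, ∑ w ∈ Finset.range v, ν.getD w 0 ≤ ∑ w ∈ Finset.range v, μ.getD w 0) : ν ≤ μ := by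
  induction ν generalizing μ with
  | nil =>
    cases μ with
    | nil => exact le_rfl
    | cons b μ => exact le_of_lt List.Lex.nil
  | cons a ν ih =>
    have h1 := h 1
    have ha := hν a List.mem_cons_self
    cases μ with
    | nil => simp at h1; omega
    | cons b μ =>
      simp only [Finset.range_one, Finset.sum_singleton, List.getD_cons_zero] at h1
      rcases h1.lt_or_eq with h2 | rfl
      · exact le_of_lt (List.Lex.rel h2)
      · have h2 : ν ≤ μ := by
          refine ih (fun p hp => hν p (List.mem_cons_of_mem _ hp)) fun v => ?_
          have := h (v + 1)
          rw [Finset.sum_range_succ', Finset.sum_range_succ'] at this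
          simpa using this
        rcases h2.lt_or_eq with h3 | rfl
        · exact le_of_lt (List.Lex.cons h3)
        · exact le_rfl

theorem getD_succ_le {μ : List ℕ} (hdec : μ.Pairwise fun p q => q ≤ p) (i : ℕ) :
    μ.getD (i + 1) 0 ≤ μ.getD i 0 := by
  by_cases hi : i + 1 < μ.length
  · rw [List.getD_eq_getElem _ _ hi, List.getD_eq_getElem _ _ (by omega : i < μ.length)]
    exact List.pairwise_iff_getElem.1 hdec i (i + 1) (by omega) hi (by omega)
  · rw [List.getD_eq_default _ _ (by omega)]
    exact Nat.zero_le _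

/-! ### Colourings of `G_μ` as patterns -/

namespace ECDigraph

/-- The colour of the cell `(i, j)` is at most `v`. -/
def CellLE (μ : List ℕ) (κ : (ferrers μ).V → ℕ+) (i j v : ℕ) : Prop :=
  ∃ (hi : i < μ.length) (hj : j < μ.get ⟨i, hi⟩), (κ ⟨⟨i, hi⟩, ⟨j, hj⟩⟩ : ℕ) ≤ v

theorem cellLE_iff {μ : List ℕ} {κ : (ferrers μ).V → ℕ+} {i j v : ℕ} (hi : i < μ.length)
    (hj : j < μ.get ⟨i, hi⟩) : CellLE μ κ i j v ↔ (κ ⟨⟨i, hi⟩, ⟨j, hj⟩⟩ : ℕ) ≤ v :=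
  ⟨fun ⟨_, _, h⟩ => h, fun h => ⟨hi, hj, h⟩⟩

theorem isProper_ferrers_iff (μ : List ℕ) (κ : (ferrers μ).V → ℕ+) :
    (ferrers μ).IsProper κ ↔
      (∀ (i j : ℕ) (hi : i < μ.length) (hj : j + 1 < μ.get ⟨i, hi⟩),
        κ ⟨⟨i, hi⟩, ⟨j, by omega⟩⟩ ≤ κ ⟨⟨i, hi⟩, ⟨j + 1, hj⟩⟩) ∧
      (∀ (i j : ℕ) (hi : i + 1 < μ.length) (hj : j < μ.get ⟨i, by omega⟩)
        (hj' : j < μ.get ⟨i + 1, hi⟩),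
        κ ⟨⟨i, by omega⟩, ⟨j, hj⟩⟩ < κ ⟨⟨i + 1, hi⟩, ⟨j, hj'⟩⟩) := by
  constructor
  · intro h
    refine ⟨fun i j hi hj => (h _ _).2.2 ?_, fun i j hi hj hj' => (h _ _).2.1 ?_⟩
    · simp [ferrers]
    · simp [ferrers]
  · rintro ⟨h1, h2⟩ ⟨⟨i, hi⟩, ⟨j, hj⟩⟩ ⟨⟨i', hi'⟩, ⟨j', hj'⟩⟩
    simp only [ferrers]
    refine ⟨fun h => ?_, fun h => ?_, fun h => ?_⟩
    · split_ifs at h <;> simp at h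
    · split_ifs at h with h3
      · obtain ⟨rfl, rfl⟩ := h3
        exact h2 _ _ _ _ _
      all_goals simp at h
    · split_ifs at h with h3 h4
      · simp at h
      · obtain ⟨rfl, rfl⟩ := h4
        exact h1 _ _ _ _

/-- The number of cells in row `i` of colour at most `v`. -/
noncomputable def rowCount (μ : List ℕ) (κ : (ferrers μ).V → ℕ+) (i v : ℕ) : ℕ :=
  haveI := Classical.decPred fun j => CellLE μ κ i j v
  ((Finset.range (μ.getD i 0)).filter fun j => CellLE μ κ i j v).card

theorem cellLE_lt {μ : List ℕ} {κ : (ferrers μ).V → ℕ+} {i j v : ℕ} (h : CellLE μ κ i j v) :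
    j < μ.getD i 0 := by
  obtain ⟨hi, hj, -⟩ := h
  rwa [List.getD_eq_getElem _ _ hi]

theorem lt_rowCount_iff {μ : List ℕ} {κ : (ferrers μ).V → ℕ+} (hκ : (ferrers μ).IsProper κ)
    (i j v : ℕ) : j < rowCount μ κ i v ↔ CellLE μ κ i j v := by
  classical
  unfold rowCount
  refine lt_card_filter_range_iff (fun j => ?_) (fun j => cellLE_lt) j
  rintro ⟨hi, hj, h⟩
  exact ⟨hi, by omega, le_trans (((isProper_ferrers_iff μ κ).1 hκ).1 i j hi hj) h⟩

/-- Interlacing is column strictness: if cell `(i + 1, j)` has colour at most `v + 1`, the cell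
above it exists, as `μ` is decreasing, and has colour at most `v`. -/
theorem isPattern_rowCount {μ : List ℕ} (hdec : μ.Pairwise fun p q => q ≤ p)
    {κ : (ferrers μ).V → ℕ+} (hκ : (ferrers μ).IsProper κ) : IsPattern μ (rowCount μ κ) where
  zero i := by
    by_contra hne
    obtain ⟨hi, hj, h⟩ := (lt_rowCount_iff hκ i 0 0).1 (Nat.pos_of_ne_zero hne)
    exact absurd h (not_le.2 (PNat.pos _))
  mono i v := by
    refine le_of_forall_lt fun j hj => ?_
    rw [lt_rowCount_iff hκ] at hj ⊢
    obtain ⟨hi, hj, h⟩ := hj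
    exact ⟨hi, hj, by omega⟩
  interlace i v := by
    refine le_of_forall_lt fun j hj => ?_
    rw [lt_rowCount_iff hκ] at hj ⊢
    have hlt := (cellLE_lt hj).trans_le (getD_succ_le hdec i)
    obtain ⟨hi, hj, h⟩ := hj
    rw [List.getD_eq_getElem _ _ (by omega : i < μ.length)] at hlt
    refine ⟨by omega, hlt, ?_⟩
    have : (κ ⟨⟨i, by omega⟩, ⟨j, hlt⟩⟩ : ℕ) < κ ⟨⟨i + 1, hi⟩, ⟨j, hj⟩⟩ :=
      ((isProper_ferrers_iff μ κ).1 hκ).2 i j hi hlt hj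
    omega
  stable := by
    -- The sum of all colours serves as a bound for each of them.
    refine ⟨∑ a, (κ a : ℕ), fun v hv i => eq_of_forall_lt_iff fun j => ?_⟩
    rw [lt_rowCount_iff hκ]
    refine ⟨cellLE_lt, fun h => ?_⟩
    have hi : i < μ.length := by
      by_contra hi
      rw [List.getD_eq_default _ _ (not_lt.1 hi)] at h
      exact absurd h (Nat.not_lt_zero _)
    rw [List.getD_eq_getElem _ _ hi] at h
    exact ⟨hi, h, (Finset.single_le_sum (f := fun a => (κ a : ℕ)) (fun _ _ => Nat.zero_le _)
      (Finset.mem_univ _)).trans hv⟩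

/-- Cell `(i, j)` receives the least `v` with `j < L i v`. Then "colour at most `v`" is equivalent
to `j < L i v`, and each pattern condition translates into a condition on colours. -/
theorem exists_colouring {μ : List ℕ} {L : ℕ → ℕ → ℕ} (hL : IsPattern μ L) :
    ∃ κ, (ferrers μ).IsProper κ ∧ rowCount μ κ = L := by
  have hex : ∀ a : (ferrers μ).V, ∃ v, a.2.1 < L a.1.1 v := by
    rintro ⟨⟨i, hi⟩, ⟨j, hj⟩⟩
    obtain ⟨N, hN⟩ := hL.stable
    refine ⟨N, ?_⟩
    simp only [hN N le_rfl, List.getD_eq_getElem _ _ hi]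
    exact hj
  classical
  have hpos : ∀ a, 0 < Nat.find (hex a) := by
    intro a
    rw [Nat.find_pos, hL.zero]
    exact Nat.not_lt_zero _
  let κ : (ferrers μ).V → ℕ+ := fun a => ⟨Nat.find (hex a), hpos a⟩
  have hgal : ∀ (i j v : ℕ) (hi : i < μ.length) (hj : j < μ.get ⟨i, hi⟩),
      (κ ⟨⟨i, hi⟩, ⟨j, hj⟩⟩ : ℕ) ≤ v ↔ j < L i v := by
    intro i j v hi hj
    change Nat.find (hex ⟨⟨i, hi⟩, ⟨j, hj⟩⟩) ≤ v ↔ _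
    rw [Nat.find_le_iff]
    exact ⟨fun ⟨w, hw, h⟩ => lt_of_lt_of_le h (hL.monotone i hw), fun h => ⟨v, le_rfl, h⟩⟩
  have hproper : (ferrers μ).IsProper κ := by
    rw [isProper_ferrers_iff]
    constructor
    · intro i j hi hj
      refine (hgal _ _ _ _ _).2 ?_
      exact (Nat.lt_succ_self j).trans ((hgal i (j + 1) _ hi hj).1 le_rfl)
    · intro i j hi hj hj'
      have h1 := (hgal (i + 1) j _ hi hj').1 le_rfl
      obtain ⟨w, hw⟩ := Nat.exists_eq_succ_of_ne_zero (κ ⟨⟨i + 1, hi⟩, ⟨j, hj'⟩⟩).ne_zero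
      rw [hw] at h1
      have h2 := (hgal i j w _ hj).2 (h1.trans_le (hL.interlace i w))
      rw [← PNat.coe_lt_coe, hw]
      exact Nat.lt_succ_iff.2 h2
  refine ⟨κ, hproper, ?_⟩
  funext i v
  refine eq_of_forall_lt_iff fun j => ?_
  rw [lt_rowCount_iff hproper]
  constructor
  · rintro ⟨hi, hj, h⟩
    exact (hgal _ _ _ _ _).1 h
  · intro h
    have h1 := h.trans_le (hL.le_getD i v)
    have hi : i < μ.length := by
      by_contra hi
      rw [List.getD_eq_default _ _ (not_lt.1 hi)] at h1
      exact absurd h1 (Nat.not_lt_zero _)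
    rw [List.getD_eq_getElem _ _ hi] at h1
    exact ⟨hi, h1, (hgal _ _ _ _ _).2 h⟩

theorem rowCount_injective {μ : List ℕ} {κ κ' : (ferrers μ).V → ℕ+}
    (hκ : (ferrers μ).IsProper κ) (hκ' : (ferrers μ).IsProper κ')
    (h : rowCount μ κ = rowCount μ κ') : κ = κ' := by
  funext ⟨⟨i, hi⟩, ⟨j, hj⟩⟩
  refine PNat.coe_injective (eq_of_forall_ge_iff fun v => ?_)
  rw [← cellLE_iff hi hj, ← cellLE_iff hi hj, ← lt_rowCount_iff hκ, ← lt_rowCount_iff hκ', h]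

theorem sum_rowCount {μ : List ℕ} (κ : (ferrers μ).V → ℕ+) (v : ℕ) :
    ∑ i ∈ Finset.range μ.length, rowCount μ κ i v = ∑ a, if (κ a : ℕ) ≤ v then 1 else 0 := by
  classical
  refine Eq.trans ?_ (Fintype.sum_sigma (fun a : (Σ i : Fin μ.length, Fin (μ.get i)) =>
    if (κ a : ℕ) ≤ v then 1 else 0)).symm
  rw [Finset.sum_range]
  refine Finset.sum_congr rfl fun i _ => ?_
  rw [rowCount, Finset.card_filter, List.getD_eq_getElem _ _ i.2, Finset.sum_range]
  refine Finset.sum_congr rfl fun j _ => ?_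
  have h : CellLE μ κ i j v ↔ (κ ⟨i, j⟩ : ℕ) ≤ v := cellLE_iff i.2 j.2
  simp only [h]

/-- Level `v` counts the cells of colour at most `v`, so the step from `v` to `v + 1` counts those
of colour `v.succPNat`. -/
theorem hasContent_rowCount_iff {μ : List ℕ} (κ : (ferrers μ).V → ℕ+) (m : ℕ+ →₀ ℕ) :
    IsPattern.HasContent μ (rowCount μ κ) m ↔ content κ = m := by
  have key : ∀ v : ℕ, ∑ i ∈ Finset.range μ.length, rowCount μ κ i (v + 1) =
      ∑ i ∈ Finset.range μ.length, rowCount μ κ i v + content κ v.succPNat := by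
    intro v
    rw [sum_rowCount, sum_rowCount, content_apply, ← Finset.sum_add_distrib]
    refine Finset.sum_congr rfl fun a _ => ?_
    have h : κ a = v.succPNat ↔ (κ a : ℕ) = v + 1 := by
      rw [← PNat.coe_inj, Nat.succPNat_coe]
    simp only [h]
    split_ifs <;> omega
  constructor
  · intro h
    ext w
    have := h w.natPred
    rw [key] at this
    simpa using this
  · rintro rfl
    exact key

theorem count_ferrers {μ : List ℕ} (hdec : μ.Pairwise fun p q => q ≤ p) (m : ℕ+ →₀ ℕ) :
    (ferrers μ).count m = Nat.card {L // IsPattern μ L ∧ IsPattern.HasContent μ L m} := by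
  refine Nat.card_congr (Equiv.ofBijective (fun κ => ⟨rowCount μ κ.1,
    isPattern_rowCount hdec κ.2.1, (hasContent_rowCount_iff _ _).2 κ.2.2⟩) ⟨?_, ?_⟩)
  · exact fun κ κ' h => Subtype.ext (rowCount_injective κ.2.1 κ'.2.1 (Subtype.ext_iff.1 h))
  · rintro ⟨L, hL, hm⟩
    obtain ⟨κ, hκ, rfl⟩ := exists_colouring hL
    exact ⟨⟨κ, hκ, (hasContent_rowCount_iff _ _).1 hm⟩, rfl⟩

theorem count_ferrers_ne_zero_iff {μ : List ℕ} (hdec : μ.Pairwise fun p q => q ≤ p)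
    (m : ℕ+ →₀ ℕ) : (ferrers μ).count m ≠ 0 ↔
      ∃ L, IsPattern μ L ∧ IsPattern.HasContent μ L m := by
  rw [count_ne_zero_iff]
  constructor
  · rintro ⟨κ, hκ, h⟩
    exact ⟨_, isPattern_rowCount hdec hκ, (hasContent_rowCount_iff _ _).2 h⟩
  · rintro ⟨L, hL, hm⟩
    obtain ⟨κ, hκ, rfl⟩ := exists_colouring hL
    exact ⟨κ, hκ, (hasContent_rowCount_iff _ _).1 hm⟩

/-- Schur functions are symmetric. -/
theorem count_ferrers_eq_of_sorted_eq {μ : List ℕ} (hdec : μ.Pairwise fun p q => q ≤ p)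
    {m m' : ℕ+ →₀ ℕ} (h : sorted m = sorted m') :
    (ferrers μ).count m = (ferrers μ).count m' :=
  eq_of_sorted_eq (fun m u => by
    rw [count_ferrers hdec, count_ferrers hdec, IsPattern.card_swap]) h

/-! ### Triangularity of the Schur coefficients -/

/-- The exponent vector of `x_1^{ν_1} x_2^{ν_2} ⋯`. -/
noncomputable def standardVec (ν : List ℕ) : ℕ+ →₀ ℕ :=
  expVec ν fun a => a.1.succPNat

theorem standardVec_injective (ν : List ℕ) :
    Function.Injective fun a : Fin ν.length => a.1.succPNat :=
  fun _ _ h => Fin.ext (Nat.succPNat_injective h)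

theorem standardVec_apply (ν : List ℕ) (v : ℕ) : standardVec ν v.succPNat = ν.getD v 0 := by
  by_cases hv : v < ν.length
  · rw [List.getD_eq_getElem _ _ hv]
    exact expVec_apply (standardVec_injective ν) ⟨v, hv⟩
  · rw [List.getD_eq_default _ _ (not_lt.1 hv)]
    exact expVec_apply_of_notMem fun a h => hv (Nat.succPNat_injective h ▸ a.2)

theorem sorted_standardVec {ν : List ℕ} (hν : ∀ p ∈ ν, 0 < p)
    (hdec : ν.Pairwise fun p q => q ≤ p) : sorted (standardVec ν) = ν :=
  sorted_expVec hν hdec (standardVec_injective ν)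

/-- Columns increase strictly from a colour at least `1`, so row `i`, counted from zero, has only
colours above `i`. -/
theorem _root_.IsPattern.eq_zero_of_le {μ : List ℕ} {L : ℕ → ℕ → ℕ} (hL : IsPattern μ L)
    (v i : ℕ) (h : v ≤ i) : L i v = 0 := by
  induction v generalizing i with
  | zero => exact hL.zero i
  | succ v ih =>
    obtain ⟨i, rfl⟩ := Nat.exists_eq_add_of_le' (Nat.le_of_succ_le h)
    cases v with
    | zero =>
      cases i with
      | zero => omega
      | succ i => exact Nat.eq_zero_of_le_zero ((hL.interlace i 0).trans_eq (hL.zero _))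
    | succ v =>
      exact Nat.eq_zero_of_le_zero ((hL.interlace (i + v) (v + 1)).trans_eq (ih _ (by omega)))

/-- By symmetry the exponents may be assumed decreasing. Cells of colour at most `v` lie in the
first `v` rows, so the sum of the first `v` exponents is at most that of the first `v` parts of `μ`;
this dominance implies the lexicographic inequality. -/
theorem sorted_le_of_count_ferrers {μ : List ℕ} (hdec : μ.Pairwise fun p q => q ≤ p)
    {m : ℕ+ →₀ ℕ} (hm : (ferrers μ).count m ≠ 0) : sorted m ≤ μ := by
  rw [count_ferrers_eq_of_sorted_eq hdec
    (sorted_standardVec (sorted_pos m) (pairwise_sorted m)).symm,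
    count_ferrers_ne_zero_iff hdec] at hm
  obtain ⟨L, hL, hm⟩ := hm
  refine le_of_prefix_sums (sorted_pos m) fun v => ?_
  have h1 : ∑ w ∈ Finset.range v, (sorted m).getD w 0 =
      ∑ i ∈ Finset.range μ.length, L i v := by
    induction v with
    | zero => simp [hL.zero]
    | succ v ih => rw [Finset.sum_range_succ, ih, hm v, standardVec_apply]
  have h2 : ∑ i ∈ Finset.range μ.length, L i v =
      ∑ i ∈ Finset.range (min μ.length v), L i v := by
    refine (Finset.sum_subset (Finset.range_mono (min_le_left _ _)) fun i hi hi' => ?_).symm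
    refine hL.eq_zero_of_le v i ?_
    rw [Finset.mem_range] at hi hi'
    omega
  rw [h1, h2]
  refine (Finset.sum_le_sum fun i _ => hL.le_getD i v).trans ?_
  exact Finset.sum_le_sum_of_subset (Finset.range_mono (min_le_right _ _))

theorem count_ferrers_of_sorted {μ : List ℕ} (hμ : ∀ p ∈ μ, 0 < p)
    (hdec : μ.Pairwise fun p q => q ≤ p)
    {m : ℕ+ →₀ ℕ} (hm : sorted m = μ) : (ferrers μ).count m ≠ 0 := by
  rw [count_ferrers_eq_of_sorted_eq hdec (hm.trans (sorted_standardVec hμ hdec).symm),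
    count_ferrers_ne_zero_iff hdec]
  -- The tableau whose row `i`, counted from zero, is filled with the colour `i + 1`.
  refine ⟨fun i v => if i < v then μ.getD i 0 else 0, ⟨fun i => ?_, fun i v => ?_, fun i v => ?_,
    ⟨μ.length, fun v hv i => ?_⟩⟩, fun v => ?_⟩
  · simp
  · split_ifs <;> omega
  · have := getD_succ_le hdec i
    split_ifs <;> omega
  · split_ifs with h
    · rfl
    · rw [List.getD_eq_default _ _ (by omega)]
  · rw [standardVec_apply]
    have h1 : ∀ i, (if i < v + 1 then μ.getD i 0 else 0) =
        (if i < v then μ.getD i 0 else 0) + if i = v then μ.getD v 0 else 0 := by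
      intro i
      rcases lt_trichotomy i v with h | h | h
      · simp [h, h.ne, Nat.lt_succ_of_lt h]
      · simp [h]
      · simp [not_lt.2 h.le, h.ne', show ¬ i < v + 1 by omega]
    simp only [h1, Finset.sum_add_distrib, Finset.sum_ite_eq', Finset.mem_range]
    split_ifs with h
    · rfl
    · rw [List.getD_eq_default _ _ (not_lt.1 h)]

theorem ferrers_column_lt {μ : List ℕ} (hdec : μ.Pairwise fun p q => q ≤ p)
    {κ : (ferrers μ).V → ℕ+} (hκ : (ferrers μ).IsProper κ) (j d i : ℕ)
    (hi : i < μ.length) (hj : j < μ.get ⟨i, hi⟩) (hi' : i + (d + 1) < μ.length)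
    (hj' : j < μ.get ⟨i + (d + 1), hi'⟩) :
    κ ⟨⟨i, hi⟩, ⟨j, hj⟩⟩ < κ ⟨⟨i + (d + 1), hi'⟩, ⟨j, hj'⟩⟩ := by
  induction d with
  | zero => exact ((isProper_ferrers_iff μ κ).1 hκ).2 i j hi' hj hj'
  | succ d ih =>
    have hlt : j < μ.get ⟨i + (d + 1), by omega⟩ :=
      hj'.trans_le (List.pairwise_iff_getElem.1 hdec _ _ _ _ (by omega))
    exact (ih (by omega) hlt).trans
      (((isProper_ferrers_iff μ κ).1 hκ).2 (i + (d + 1)) j hi' hlt hj')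

/-- Cells of equal colour lie in different columns, so a colour occurs at most as often as the first
row is long, and that length is a part of `μ`. -/
theorem content_ferrers_lt {r : ℕ∞} {μ : List ℕ} (hdec : μ.Pairwise fun p q => q ≤ p)
    (hr : ∀ p ∈ μ, (p : ℕ∞) < r) (κ : (ferrers μ).V → ℕ+) (hκ : (ferrers μ).IsProper κ)
    (v : ℕ+) (hv : content κ v ≠ 0) : (content κ v : ℕ∞) < r := by
  classical
  obtain ⟨⟨⟨i₀, hi₀⟩, -⟩, -⟩ := (content_ne_zero_iff κ v).1 hv
  have hlen : 0 < μ.length := by omega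
  refine lt_of_le_of_lt (Nat.cast_le.2 ?_) (hr _ (List.get_mem μ ⟨0, hlen⟩))
  rw [content_apply, ← Finset.card_filter, ← Finset.card_range (μ.get ⟨0, hlen⟩)]
  refine Finset.card_le_card_of_injOn (fun a => a.2.1) ?_ ?_
  · rintro ⟨⟨i, hi⟩, ⟨j, hj⟩⟩ -
    simp only [Finset.coe_range, Set.mem_Iio]
    refine hj.trans_le ?_
    rcases Nat.eq_zero_or_pos i with rfl | hpos
    · exact le_rfl
    · exact List.pairwise_iff_getElem.1 hdec _ _ _ _ hpos
  · rintro ⟨⟨i, hi⟩, ⟨j, hj⟩⟩ h ⟨⟨i', hi'⟩, ⟨j', hj'⟩⟩ h' hjj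
    simp only at hjj
    subst hjj
    have e : κ ⟨⟨i, hi⟩, ⟨j, hj⟩⟩ = κ ⟨⟨i', hi'⟩, ⟨j, hj'⟩⟩ :=
      (Finset.mem_filter.1 h).2.trans (Finset.mem_filter.1 h').2.symm
    rcases lt_trichotomy i i' with hlt | rfl | hlt
    · obtain ⟨d, rfl⟩ := Nat.exists_eq_add_of_lt hlt
      exact absurd e (ferrers_column_lt hdec hκ j d i hi hj hi' hj').ne
    · rfl
    · obtain ⟨d, rfl⟩ := Nat.exists_eq_add_of_lt hlt
      exact absurd e (ferrers_column_lt hdec hκ j d i' hi' hj' hi hj).ne'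

theorem card_ferrers (μ : List ℕ) : Fintype.card (ferrers μ).V = μ.sum := by
  refine (Fintype.card_sigma (α := fun i : Fin μ.length => Fin (μ.get i))).trans ?_
  simp only [Fintype.card_fin]
  rw [← List.sum_ofFn, List.ofFn_get]

theorem partitionLike_ferrers {r : ℕ∞} {μ : List ℕ} (hμ : ∀ p ∈ μ, 0 < p)
    (hdec : μ.Pairwise fun p q => q ≤ p) (hr : ∀ p ∈ μ, (p : ℕ∞) < r) :
    PartitionLike r μ (ferrers μ) where
  content_lt := content_ferrers_lt hdec hr
  card_eq := card_ferrers μ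
  sorted_of_count _ := sorted_le_of_count_ferrers hdec
  count_of_sorted _ := count_ferrers_of_sorted hμ hdec
  count_eq _ _ := count_ferrers_eq_of_sorted_eq hdec

end ECDigraph

/-! ### Linear independence and the four bases -/

open ECDigraph

/-- A family is linearly independent if it is triangular with respect to linear functionals and a
rank. -/
theorem linearIndependent_of_triangular {ι V α : Type} [AddCommGroup V] [Module ℚ V]
    [LinearOrder α] (f : ι → V) (φ : ι → V →ₗ[ℚ] ℚ) (rank : ι → α)
    (hne : ∀ i, φ i (f i) ≠ 0) (htri : ∀ i j, φ i (f j) ≠ 0 → i = j ∨ rank i < rank j) :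
    LinearIndependent ℚ f := by
  rw [linearIndependent_iff]
  intro l hl
  by_contra hne'
  -- At an index of maximal rank in the support, the functional `φ i` annihilates all other terms of
  -- the relation.
  obtain ⟨i, hi, hmax⟩ := l.support.exists_max_image rank (Finsupp.support_nonempty_iff.2 hne')
  have h := congrArg (φ i) hl
  rw [Finsupp.linearCombination_apply, Finsupp.sum, map_sum, map_zero,
    Finset.sum_eq_single_of_mem i hi] at h
  · rw [map_smul, smul_eq_mul, mul_eq_zero] at h
    exact h.elim (Finsupp.mem_support_iff.1 hi) (hne i)
  · intro j hj hji
    rw [map_smul, smul_eq_mul, mul_eq_zero]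
    right
    by_contra h'
    rcases htri i j h' with h' | h'
    · exact hji h'.symm
    · exact absurd (hmax j hj) (not_le.2 h')

namespace RComposition

variable {r : ℕ∞} {n : ℕ}

theorem ext_iff' {c d : RComposition r n} : c = d ↔ c.β = d.β ∧ c.μ = d.μ := by
  cases c
  cases d
  simp

instance finite : Finite (RComposition r n) := by
  have hfin : {l : List (Fin (n + 1)) | l.length ≤ n}.Finite := List.finite_length_le _ _
  have hfin' := hfin.image (List.map fun i : Fin (n + 1) => (i : ℕ))
  have hmem : ∀ l : List ℕ, (∀ p ∈ l, 0 < p) → l.sum ≤ n →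
      l ∈ (List.map fun i : Fin (n + 1) => (i : ℕ)) '' {l | l.length ≤ n} := by
    intro l hl hs
    have hlt : ∀ p ∈ l, p < n + 1 := fun p hp =>
      Nat.lt_succ_of_le ((List.le_sum_of_mem hp).trans hs)
    refine ⟨l.pmap (fun p hp => ⟨p, hp⟩) hlt, ?_, ?_⟩
    · change (l.pmap _ hlt).length ≤ n
      rw [List.length_pmap]
      exact (List.length_le_sum_of_one_le l hl).trans hs
    · simp [List.map_pmap]
  have := (hfin'.prod hfin').to_subtype
  refine Finite.of_injective (fun c : RComposition r n =>
    (⟨(c.β, c.μ), hmem _ c.β_pos ((Nat.le_add_right _ _).trans_eq c.size_eq),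
      hmem _ c.μ_pos ((Nat.le_add_left _ _).trans_eq c.size_eq)⟩ : ↥(_ ×ˢ _ : Set (List ℕ × List ℕ)))) ?_
  intro c d h
  rw [ext_iff']
  exact Prod.ext_iff.1 (Subtype.ext_iff.1 h)

/-- The monomial with exponent vector `m` occurs in `M_{(β,μ)}`. -/
def IsType (c : RComposition r n) (m : ℕ+ →₀ ℕ) : Prop :=
  flat (large r m) = c.β ∧ sorted (small r m) = c.μ

theorem IsType.eq {c d : RComposition r n} {m : ℕ+ →₀ ℕ} (hc : c.IsType m) (hd : d.IsType m) :
    c = d :=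
  ext_iff'.2 ⟨hc.1.symm.trans hd.1, hc.2.symm.trans hd.2⟩

theorem exists_isType (m : ℕ+ →₀ ℕ) (hm : m.degree = n) : ∃ c : RComposition r n, c.IsType m := by
  classical
  refine ⟨⟨flat (large r m), sorted (small r m), flat_pos _, sorted_pos _, pairwise_sorted _,
    fun p hp => ?_, fun p hp => ?_, ?_⟩, rfl, rfl⟩
  · obtain ⟨v, rfl, hv⟩ := mem_flat hp
    rw [large_apply] at hv ⊢
    split_ifs at hv ⊢ with h
    · exact h
    · exact absurd rfl hv
  · obtain ⟨v, rfl, hv⟩ := mem_sorted hp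
    rw [small_apply] at hv ⊢
    split_ifs at hv ⊢ with h
    · exact h
    · exact absurd rfl hv
  · rw [← degree_eq_sum_flat, ← degree_eq_sum_sorted, ← map_add, large_add_small, hm]

theorem exists_monomial (c : RComposition r n) : ∃ m, c.IsType m := by
  let f : Fin c.β.length → ℕ+ := fun a => a.1.succPNat
  -- The shift by the length of `β` keeps the two sets of variables disjoint.
  let g : Fin c.μ.length → ℕ+ := fun a => (c.β.length + a.1).succPNat
  have hf : StrictMono f := fun a b h => Nat.succPNat_strictMono h
  have hg : Function.Injective g := fun a b h => by
    have := Nat.succPNat_injective h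
    exact Fin.ext (by omega)
  obtain ⟨h1, h2⟩ := eq_large_small (r := r) (m₁ := expVec c.β f) (m₂ := expVec c.μ g) rfl
    (fun v => by
      by_contra! hv
      obtain ⟨⟨a, ha⟩, ⟨b, hb⟩⟩ := And.intro
        ((mem_support_expVec c.β_pos hf.injective v).1 (Finsupp.mem_support_iff.2 hv.1))
        ((mem_support_expVec c.μ_pos hg v).1 (Finsupp.mem_support_iff.2 hv.2))
      have := Nat.succPNat_injective (ha.trans hb.symm)
      have := a.2
      omega)
    (fun v hv => by
      obtain ⟨a, rfl⟩ :=
        (mem_support_expVec c.β_pos hf.injective v).1 (Finsupp.mem_support_iff.2 hv)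
      rw [expVec_apply hf.injective]
      exact c.le_β _ (List.get_mem _ _))
    (fun v hv => by
      obtain ⟨a, rfl⟩ := (mem_support_expVec c.μ_pos hg v).1 (Finsupp.mem_support_iff.2 hv)
      rw [expVec_apply hg]
      exact c.μ_lt _ (List.get_mem _ _))
  refine ⟨expVec c.β f + expVec c.μ g, ?_, ?_⟩
  · rw [← h1, flat_expVec c.β_pos hf]
  · rw [← h2, sorted_expVec c.μ_pos c.μ_decreasing hg]

/-- A monomial that occurs in `M_{(β,μ)}`. -/
noncomputable def monomial (c : RComposition r n) : ℕ+ →₀ ℕ := c.exists_monomial.choose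

theorem isType_monomial (c : RComposition r n) : c.IsType c.monomial :=
  c.exists_monomial.choose_spec

section

variable {P Q : RComposition r n → ECDigraph}

/-- The generalized chromatic functions of the dashed sums. -/
noncomputable def chromaticFamily (P Q : RComposition r n → ECDigraph) (c : RComposition r n) :
    MvPowerSeries ℕ+ ℚ :=
  (ECDigraph.sum EdgeColour.dashed (P c) (Q c)).chromaticFunction

theorem coeff_chromaticFamily (hP : ∀ c, CompositionLike r c.β (P c))
    (hQ : ∀ c, PartitionLike r c.μ (Q c)) (c : RComposition r n) (m : ℕ+ →₀ ℕ) :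
    MvPowerSeries.coeff m (chromaticFamily P Q c) =
      ((P c).count (large r m) : ℚ) * (Q c).count (small r m) := by
  rw [chromaticFamily, coeff_chromaticFunction,
    count_sum_dashed _ _ (hP c).le_content (hQ c).content_lt, Nat.cast_mul]

theorem coeff_chromaticFamily_of_degree_ne (hP : ∀ c, CompositionLike r c.β (P c))
    (hQ : ∀ c, PartitionLike r c.μ (Q c)) (c : RComposition r n) {m : ℕ+ →₀ ℕ}
    (hm : m.degree ≠ n) : MvPowerSeries.coeff m (chromaticFamily P Q c) = 0 := by
  rw [chromaticFamily, coeff_chromaticFunction, Nat.cast_eq_zero]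
  by_contra h
  obtain ⟨κ, -, rfl⟩ := (count_ne_zero_iff _ _).1 h
  rw [degree_content] at hm
  refine hm ((Fintype.card_sum (α := (P c).V) (β := (Q c).V)).trans ?_)
  rw [(hP c).card_eq, (hQ c).card_eq, c.size_eq]

/-- The factor for `P` is quasisymmetric in the large exponents and the factor for `Q` is symmetric
in the small ones, so the coefficient is constant on each type. -/
theorem coeff_chromaticFamily_eq (hP : ∀ c, CompositionLike r c.β (P c))
    (hQ : ∀ c, PartitionLike r c.μ (Q c)) (c : RComposition r n) {d : RComposition r n}
    {m m' : ℕ+ →₀ ℕ} (hm : d.IsType m) (hm' : d.IsType m') :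
    MvPowerSeries.coeff m (chromaticFamily P Q c) =
      MvPowerSeries.coeff m' (chromaticFamily P Q c) := by
  rw [coeff_chromaticFamily hP hQ, coeff_chromaticFamily hP hQ,
    (P c).count_eq_of_flat_eq (hm.1.trans hm'.1.symm),
    (hQ c).count_eq _ _ (hm.2.trans hm'.2.symm)]

theorem linearIndependent_chromaticFamily (hP : ∀ c, CompositionLike r c.β (P c))
    (hQ : ∀ c, PartitionLike r c.μ (Q c)) : LinearIndependent ℚ (chromaticFamily P Q) := by
  refine linearIndependent_of_triangular _ (fun c => MvPowerSeries.coeff c.monomial)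
    -- Merging blocks lowers the length of `β`. When no blocks merge, `β` is unchanged and the
    -- lexicographic order of `μ` decides.
    (fun c => toLex (c.β.length, c.μ)) (fun c => ?_) fun d c h => ?_
  · rw [coeff_chromaticFamily hP hQ]
    exact mul_ne_zero (Nat.cast_ne_zero.2 ((hP c).count_of_flat _ c.isType_monomial.1))
      (Nat.cast_ne_zero.2 ((hQ c).count_of_sorted _ c.isType_monomial.2))
  · rw [coeff_chromaticFamily hP hQ] at h
    have h1 := (hP c).flat_of_count _ (Nat.cast_ne_zero.1 (left_ne_zero_of_mul h))
    have h2 := (hQ c).sorted_of_count _ (Nat.cast_ne_zero.1 (right_ne_zero_of_mul h))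
    rw [d.isType_monomial.1] at h1
    rw [d.isType_monomial.2] at h2
    rcases h1 with h1 | h1
    · rcases h2.eq_or_lt with h2 | h2
      · exact Or.inl (ext_iff'.2 ⟨h1, h2⟩)
      · exact Or.inr (Prod.Lex.toLex_lt_toLex.2 (Or.inr ⟨congrArg List.length h1, h2⟩))
    · exact Or.inr (Prod.Lex.toLex_lt_toLex.2 (Or.inl h1))

end

/-- The iterated solid sum of the cycles of `β`. -/
def solidCycles (c : RComposition r n) : ECDigraph :=
  listSum EdgeColour.solid (c.β.map cycle)

/-- The iterated double sum of the cycles of `β`. -/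
def doubleCycles (c : RComposition r n) : ECDigraph :=
  listSum EdgeColour.double (c.β.map cycle)

/-- The iterated dashed sum of the cycles of `μ`. -/
def dashedCycles (c : RComposition r n) : ECDigraph :=
  listSum EdgeColour.dashed (c.μ.map cycle)

theorem compositionLike_solidCycles (c : RComposition r n) :
    CompositionLike r c.β c.solidCycles := compositionLike_solid c.β_pos c.le_β

theorem compositionLike_doubleCycles (c : RComposition r n) :
    CompositionLike r c.β c.doubleCycles := compositionLike_double c.β_pos c.le_β

theorem partitionLike_dashedCycles (c : RComposition r n) :
    PartitionLike r c.μ c.dashedCycles := partitionLike_dashed c.μ_pos c.μ_decreasing c.μ_lt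

theorem partitionLike_ferrers (c : RComposition r n) :
    PartitionLike r c.μ (ferrers c.μ) :=
  ECDigraph.partitionLike_ferrers c.μ_pos c.μ_decreasing c.μ_lt

theorem M_eq_chromaticFamily :
    (fun c : RComposition r n => c.M) = chromaticFamily solidCycles dashedCycles :=
  funext fun c => c.M_eq_chromaticFunction

theorem coeff_M_ne_zero_iff (c : RComposition r n) (m : ℕ+ →₀ ℕ) :
    MvPowerSeries.coeff m c.M ≠ 0 ↔ c.IsType m := by
  rw [congrFun M_eq_chromaticFamily c,
    coeff_chromaticFamily compositionLike_solidCycles partitionLike_dashedCycles]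
  constructor
  · intro h
    exact ⟨flat_of_count_solid c.β_pos (Nat.cast_ne_zero.1 (left_ne_zero_of_mul h)),
      sorted_of_count_dashed c.μ_pos c.μ_decreasing
        (Nat.cast_ne_zero.1 (right_ne_zero_of_mul h))⟩
  · intro h
    exact mul_ne_zero
      (Nat.cast_ne_zero.2 (c.compositionLike_solidCycles.count_of_flat _ h.1))
      (Nat.cast_ne_zero.2 (c.partitionLike_dashedCycles.count_of_sorted _ h.2))

theorem chromaticFamily_mem {P Q : RComposition r n → ECDigraph}
    (hP : ∀ c, CompositionLike r c.β (P c)) (hQ : ∀ c, PartitionLike r c.μ (Q c))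
    (c : RComposition r n) : chromaticFamily P Q c ∈ QSymR r n := by
  have := Fintype.ofFinite (RComposition r n)
  -- The functions `d.M` have disjoint supports and both sides are constant on each type, so one
  -- monomial per type fixes the coefficients. The division is needed because repeated parts of `μ`
  -- make the coefficients of `d.M` exceed `1`.
  have key : chromaticFamily P Q c = ∑ d : RComposition r n,
      (MvPowerSeries.coeff d.monomial (chromaticFamily P Q c) /
        MvPowerSeries.coeff d.monomial d.M) • d.M := by
    ext m
    rw [map_sum]
    simp only [map_smul, smul_eq_mul]
    by_cases hm : m.degree = n
    · obtain ⟨d, hd⟩ := exists_isType (r := r) m hm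
      rw [Finset.sum_eq_single_of_mem d (Finset.mem_univ d)]
      · have e : MvPowerSeries.coeff d.monomial d.M = MvPowerSeries.coeff m d.M := by
          rw [congrFun M_eq_chromaticFamily d]
          exact coeff_chromaticFamily_eq compositionLike_solidCycles partitionLike_dashedCycles d
            d.isType_monomial hd
        rw [coeff_chromaticFamily_eq hP hQ c hd d.isType_monomial, e,
          div_mul_cancel₀ _ ((coeff_M_ne_zero_iff d m).2 hd)]
      · intro e _ hne
        rw [mul_eq_zero]
        right
        by_contra h
        exact hne (((coeff_M_ne_zero_iff e m).1 h).eq hd)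
    · rw [coeff_chromaticFamily_of_degree_ne hP hQ c hm]
      refine (Finset.sum_eq_zero fun d _ => ?_).symm
      rw [congrFun M_eq_chromaticFamily d, coeff_chromaticFamily_of_degree_ne
        compositionLike_solidCycles partitionLike_dashedCycles d hm, mul_zero]
  rw [key]
  exact Submodule.sum_mem _ fun d _ =>
    Submodule.smul_mem _ _ (Submodule.subset_span ⟨d, rfl⟩)

theorem linearIndependent_M : LinearIndependent ℚ fun c : RComposition r n => c.M := by
  rw [M_eq_chromaticFamily]
  exact linearIndependent_chromaticFamily compositionLike_solidCycles partitionLike_dashedCycles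

/-- The `M` form a basis of their span by independence. Any other independent family in this space
with the same finite index set has as many members as the dimension, hence is a basis. -/
theorem exists_basis {P Q : RComposition r n → ECDigraph}
    (hP : ∀ c, CompositionLike r c.β (P c)) (hQ : ∀ c, PartitionLike r c.μ (Q c)) :
    ∃ b : Module.Basis (RComposition r n) ℚ (QSymR r n),
      ∀ c, (b c : MvPowerSeries ℕ+ ℚ) = chromaticFamily P Q c := by
  have := Fintype.ofFinite (RComposition r n)
  let bM : Module.Basis (RComposition r n) ℚ (QSymR r n) := Module.Basis.span linearIndependent_M
  have : FiniteDimensional ℚ (QSymR r n) := bM.finiteDimensional_of_finite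
  have hli : LinearIndependent ℚ (fun c : RComposition r n =>
      (⟨chromaticFamily P Q c, chromaticFamily_mem hP hQ c⟩ : QSymR r n)) :=
    LinearIndependent.of_comp (QSymR r n).subtype (linearIndependent_chromaticFamily hP hQ)
  refine ⟨basisOfLinearIndependentOfCardEqFinrank' _ hli
    (Module.finrank_eq_card_basis bM).symm, fun c => ?_⟩
  rw [coe_basisOfLinearIndependentOfCardEqFinrank']

end RComposition

theorem mainTheorem6 (r : ℕ∞) (hr : 1 ≤ r) (n : ℕ) :
    (∀ c : RComposition r n, c.M = c.digraphM.chromaticFunction) ∧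
    (∃ b : Module.Basis (RComposition r n) ℚ (QSymR r n),
      ∀ c, (b c : MvPowerSeries ℕ+ ℚ) = c.M) ∧
    (∃ b : Module.Basis (RComposition r n) ℚ (QSymR r n),
      ∀ c, (b c : MvPowerSeries ℕ+ ℚ) = c.S) ∧
    (∃ b : Module.Basis (RComposition r n) ℚ (QSymR r n),
      ∀ c, (b c : MvPowerSeries ℕ+ ℚ) = c.Fbar) ∧
    (∃ b : Module.Basis (RComposition r n) ℚ (QSymR r n),
      ∀ c, (b c : MvPowerSeries ℕ+ ℚ) = c.Sbar) := by
  refine ⟨fun c => c.M_eq_chromaticFunction, ?_,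
    RComposition.exists_basis RComposition.compositionLike_solidCycles
      RComposition.partitionLike_ferrers,
    RComposition.exists_basis RComposition.compositionLike_doubleCycles
      RComposition.partitionLike_dashedCycles,
    RComposition.exists_basis RComposition.compositionLike_doubleCycles
      RComposition.partitionLike_ferrers⟩
  obtain ⟨b, hb⟩ := RComposition.exists_basis (r := r) (n := n)
    RComposition.compositionLike_solidCycles RComposition.partitionLike_dashedCycles
  exact ⟨b, fun c => (hb c).trans (congrFun RComposition.M_eq_chromaticFamily c).symm⟩
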